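/- Let $N\in\{2,3,5\}$ and let $k$ be an integer with $1\le k\le 4$. Let $\Gamma_0(N)^+$ be the subgroup of $\mathrm{GL}_2(\mathbb{Q})$ generated by $\Gamma_0(N)$ and all integral matrices $\begin{pmatrix} mx&y\\Nz&mw\end{pmatrix}$ of determinant $m$, $m\mid N$, $m>0$. Let $\chi:\Gamma_0(N)^+\to\mathbb{C}^\times$ be a character whose restriction to $\Gamma_0(N)$ is $\begin{pmatrix}a&b\\c&d\end{pmatrix}\mapsto\chi_0(d)$ for a real (trivial or quadratic) Dirichlet character $\chi_0$ modulo $N$ with $\chi_0(-1)=(-1)^k$. Let $M_k(\Gamma_0(N)^+,\chi)$ be the space of holomorphic functions $f$ on the upper half plane $\mathbb{H}$ that are holomorphic at the cusps and satisfy $\det(g)^{k/2}(cz+d)^{-k}f(gz)=\chi(g)f(z)$ for all $g=\begin{pmatrix}a&b\\c&d\end{pmatrix}\in\Gamma_0(N)^+$. Let $\mathcal{E}_k(N,\chi_0)$ be the space spanned by the functions $f_k(\ell z;\chi_1,\chi_2)$, where $\chi_i$ is a Dirichlet character modulo $N_i$, $\ell N_1N_2\mid N$, $\chi_1\chi_2=\chi_0$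 as characters modulo $N$, and either both $\chi_i$ are primitive (not both trivial if $k=2$), or $k=2$, both are trivial, $N_1=1$ and $N_2$ is prime. Here $$f_k(z;\chi_1,\chi_2)=a_0+\sum_{n\ge1}\Bigl(\sum_{d\mid n}\chi_1(n/d)\chi_2(d)d^{k-1}\Bigr)e^{2\pi i nz},$$ with $a_0=-B_{k,\chi_2}/(2k)$ if $N_1=1$, $a_0=-B_{1,\chi_1}/2$ if $k=1$ and $N_2=1\neq N_1$, and $a_0=0$ otherwise, where $B_{k,\chi}=M^{k-1}\sum_{a=1}^{M}\chi(a)B_k(a/M)$ for $\chi$ modulo $M$. Let $E_k^{(\chi)}$ be the element of $M_k(\Gamma_0(N)^+,\chi)\cap\mathcal{E}_k(N,\chi_0)$ whose Fourier expansion at $\infty$ has constant term $1$, whenever there is one. Then: a) If $N=2$, all zeros of $E_k^{(\chi)}$ in the fundamental domain $\{z\in\mathbb{H}: |z|\ge\frac1{\sqrt2},\,-\frac12\le\mathrm{Re}\,z\le0\}\cup\{z\in\mathbb{H}: |z|>\frac1{\sqrt2},\,0\le\mathrm{Re}\,z<\frac12\}$ lie on the arc $\{z: |z|=\frac1{\sqrt2},\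 \frac{\pi}{2}\le\arg z\le\frac{3\pi}{4}\}$. b) If $N=3$, all zeros of $E_k^{(\chi)}$ in the fundamental domain $\{z\in\mathbb{H}: |z|\ge\frac1{\sqrt3},\,-\frac12\le\mathrm{Re}\,z\le0\}\cup\{z\in\mathbb{H}: |z|>\frac1{\sqrt3},\,0\le\mathrm{Re}\,z<\frac12\}$ lie on the arc $\{z: |z|=\frac1{\sqrt3},\ \frac{\pi}{2}\le\arg z\le\frac{5\pi}{6}\}$. c) If $N=5$, all zeros of $E_k^{(\chi)}$ in the fundamental domain $$F=\{z\in\mathbb{H}: |z|\ge\tfrac1{\sqrt5},\,|z+\tfrac12|\ge\tfrac1{2\sqrt5},\,-\tfrac12\le\mathrm{Re}\,z\le0\}\cup\{z\in\mathbb{H}: |z|>\tfrac1{\sqrt5},\,|z-\tfrac12|>\tfrac1{2\sqrt5},\,0\le\mathrm{Re}\,z<\tfrac12\}$$ lie on $F\cap\{z: |z|=\frac1{\sqrt5}\text{ or }|z+\frac12|=\frac1{2\sqrt5}\}$. -/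

import Mathlib

open scoped MatrixGroups ModularForm Manifold

noncomputable section

/-! ### The groups `Γ₀(N)⁺` -/

/-- The Atkin-Lehner matrices of level `N`: all real matrices `(m x, y; N z, m w)` with `m ∣ N`,
integers `x, y, z, w` and determinant `m`. -/
def atkinLehnerSet (N : ℕ) : Set (GL (Fin 2) ℝ) :=
  {g | ∃ m : ℕ, 0 < m ∧ m ∣ N ∧ ∃ x y z w : ℤ,
    (m * x) * (m * w) - y * (N * z) = (m : ℤ) ∧
    (g : Matrix (Fin 2) (Fin 2) ℝ) = !![(m : ℝ) * x, (y : ℝ); (N : ℝ) * z, (m : ℝ) * w]}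

/-- `Γ₀(N)⁺`, the group generated by `Γ₀(N)` and the Atkin-Lehner matrices of level `N`
(as matrices, not modulo scalars). -/
def Gamma0Plus (N : ℕ) : Subgroup (GL (Fin 2) ℝ) :=
  Subgroup.closure
    (((CongruenceSubgroup.Gamma0 N).map (Matrix.SpecialLinearGroup.mapGL ℝ) :
        Set (GL (Fin 2) ℝ)) ∪ atkinLehnerSet N)

theorem mapGL_mem_Gamma0Plus {N : ℕ} {γ : SL(2, ℤ)} (hγ : γ ∈ CongruenceSubgroup.Gamma0 N) :
    Matrix.SpecialLinearGroup.mapGL ℝ γ ∈ Gamma0Plus N :=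
  Subgroup.subset_closure (Or.inl (Subgroup.mem_map_of_mem _ hγ))

/-- The character `χ` of `Γ₀(N)⁺` restricts on `Γ₀(N)` to the character `(a, b; c, d) ↦ χ₀(d)`
given by the Dirichlet character `χ₀` modulo `N` (for real `χ₀`, `χ₀(d) = χ₀(a)`). -/
def RestrictsTo {N : ℕ} (χ : Gamma0Plus N →* ℂˣ) (χ₀ : DirichletCharacter ℂ N) : Prop :=
  ∀ (γ : SL(2, ℤ)) (hγ : γ ∈ CongruenceSubgroup.Gamma0 N),
    (χ ⟨Matrix.SpecialLinearGroup.mapGL ℝ γ, mapGL_mem_Gamma0Plus hγ⟩ : ℂ) =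
      χ₀ ((γ 1 1 : ℤ) : ZMod N)

/-! ### Modular forms for `Γ₀(N)⁺` with character -/

/-- The weight `k` slash operator in the normalization
`(f|g)(z) = det(g)^{k/2} (c z + d)^{-k} f(g z)`, under which positive scalar matrices
act trivially (used only for `det g > 0`). -/
def normSlash (k : ℕ) (f : UpperHalfPlane → ℂ) (g : GL (Fin 2) ℝ) (z : UpperHalfPlane) : ℂ :=
  ((((g.det : ℝˣ) : ℝ) ^ ((k : ℝ) / 2) : ℝ) : ℂ) * (UpperHalfPlane.denom g z ^ k)⁻¹ * f (g • z)

/-- `f ∈ M_k(Γ₀(N)⁺, χ)`: `f` is holomorphic on the upper half plane, satisfies `f|g = χ(g) f`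
for all `g` in `Γ₀(N)⁺`, and is holomorphic at all cusps. -/
structure IsModularFormPlus (N k : ℕ) (χ : Gamma0Plus N →* ℂˣ) (f : UpperHalfPlane → ℂ) :
    Prop where
  holo : MDiff f
  slash_eq : ∀ (g : Gamma0Plus N) (z : UpperHalfPlane),
    normSlash k f (g : GL (Fin 2) ℝ) z = (χ g : ℂ) * f z
  bdd_at_cusps : ∀ γ : SL(2, ℤ), UpperHalfPlane.IsBoundedAtImInfty (f ∣[(k : ℤ)] γ)

/-! ### Eisenstein series -/

/-- The generalized Bernoulli number
`B_{k,χ} = M^{k-1} ∑_{a=1}^{M} χ(a) B_k(a/M)` of a Dirichlet character `χ` modulo `M`, `k ≥ 1`. -/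
def generalizedBernoulli (k : ℕ) {M : ℕ} (χ : DirichletCharacter ℂ M) : ℂ :=
  (M : ℂ) ^ (k - 1) * ∑ a ∈ Finset.Icc 1 M,
    χ (a : ZMod M) * ((((Polynomial.bernoulli k).eval ((a : ℚ) / (M : ℚ)) : ℚ)) : ℂ)

/-- The Fourier coefficients of `f_k(z; χ₁, χ₂)`, `k ≥ 1`.  In all cases where it is used, `χ_i` is
trivial with `N_i = 1`, or nontrivial, or else `k = 2`, `N₁ = 1` and `χ₂` is trivial modulo a
prime `p = N₂`; in the last case the constant term `-B_{2,χ₂}/4` is `(p - 1)/24`. -/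
def eisensteinCoeff (k : ℕ) {N₁ N₂ : ℕ} (χ₁ : DirichletCharacter ℂ N₁)
    (χ₂ : DirichletCharacter ℂ N₂) (n : ℕ) : ℂ :=
  if n = 0 then
    if N₁ = 1 then -generalizedBernoulli k χ₂ / (2 * k)
    else if k = 1 ∧ N₂ = 1 then -generalizedBernoulli k χ₁ / (2 * k)
    else 0
  else ∑ d ∈ n.divisors, χ₁ ((n / d : ℕ) : ZMod N₁) * χ₂ (d : ZMod N₂) * (d : ℂ) ^ (k - 1)

/-- The Eisenstein series `f_k(w; χ₁, χ₂) = ∑_{n ≥ 0} a_n e^{2π i n w}`. -/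
def eisensteinSeries₂ (k : ℕ) {N₁ N₂ : ℕ} (χ₁ : DirichletCharacter ℂ N₁)
    (χ₂ : DirichletCharacter ℂ N₂) (w : ℂ) : ℂ :=
  ∑' n : ℕ, eisensteinCoeff k χ₁ χ₂ n * Complex.exp (2 * Real.pi * Complex.I * n * w)

/-- The space `𝓔_k(N, χ₀)` (`k ≥ 1`), spanned by the `f_k(ℓ z; χ₁, χ₂)` with `ℓ N₁ N₂ ∣ N` and
`χ₁ χ₂ = χ₀`, where `χ₁`, `χ₂` are primitive and not both trivial if `k = 2`, or else `k = 2`,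
`χ₁`, `χ₂` are trivial, `N₁ = 1` and `N₂` is a prime. -/
def eisensteinSpace (N k : ℕ) (χ₀ : DirichletCharacter ℂ N) :
    Submodule ℂ (UpperHalfPlane → ℂ) :=
  Submodule.span ℂ
    {f | ∃ (N₁ N₂ ℓ : ℕ) (h₁ : N₁ ∣ N) (h₂ : N₂ ∣ N)
        (χ₁ : DirichletCharacter ℂ N₁) (χ₂ : DirichletCharacter ℂ N₂),
      ℓ * N₁ * N₂ ∣ N ∧
      DirichletCharacter.changeLevel h₁ χ₁ * DirichletCharacter.changeLevel h₂ χ₂ = χ₀ ∧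
      ((χ₁.IsPrimitive ∧ χ₂.IsPrimitive ∧ ¬ (k = 2 ∧ χ₁ = 1 ∧ χ₂ = 1)) ∨
        (k = 2 ∧ χ₁ = 1 ∧ χ₂ = 1 ∧ N₁ = 1 ∧ N₂.Prime)) ∧
      f = fun z : UpperHalfPlane => eisensteinSeries₂ k χ₁ χ₂ ((ℓ : ℂ) * (z : ℂ))}

/-- `f` is the normalized Eisenstein series `E_k^{(χ)}` of level `N`, where `χ` restricts to `χ₀`:
it lies in `𝓔_k(N, χ)⁺ = M_k(Γ₀(N)⁺, χ) ∩ 𝓔_k(N, χ₀)`, and the constant term of its Fourier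
expansion at `∞` is `1`. -/
structure IsEisensteinPlus (N k : ℕ) (χ₀ : DirichletCharacter ℂ N) (χ : Gamma0Plus N →* ℂˣ)
    (f : UpperHalfPlane → ℂ) : Prop where
  modular : IsModularFormPlus N k χ f
  mem_eisensteinSpace : f ∈ eisensteinSpace N k χ₀
  constantTerm : Filter.Tendsto f UpperHalfPlane.atImInfty (nhds 1)

/-! ### Fundamental domains and arcs -/

/-- The fundamental domain of `Γ₀(p)⁺` for `p = 2, 3`. -/
def fundDomain (p : ℕ) : Set UpperHalfPlane :=
  {z | 1 / √(p : ℝ) ≤ ‖(z : ℂ)‖ ∧ -(1 / 2) ≤ z.re ∧ z.re ≤ 0} ∪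
  {z | 1 / √(p : ℝ) < ‖(z : ℂ)‖ ∧ 0 ≤ z.re ∧ z.re < 1 / 2}

/-- The fundamental domain of `Γ₀(5)⁺`. -/
def fundDomain5 : Set UpperHalfPlane :=
  {z | 1 / √5 ≤ ‖(z : ℂ)‖ ∧ 1 / (2 * √5) ≤ ‖(z : ℂ) + 1 / 2‖ ∧ -(1 / 2) ≤ z.re ∧ z.re ≤ 0} ∪
  {z | 1 / √5 < ‖(z : ℂ)‖ ∧ 1 / (2 * √5) < ‖(z : ℂ) - 1 / 2‖ ∧ 0 ≤ z.re ∧ z.re < 1 / 2}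

/-- The arc `|z| = 1/√2`, `π/2 ≤ arg z ≤ 3π/4`. -/
def arc2 : Set ℂ :=
  {z | ‖z‖ = 1 / √2 ∧ Real.pi / 2 ≤ z.arg ∧ z.arg ≤ 3 * Real.pi / 4}

/-- The arc `|z| = 1/√3`, `π/2 ≤ arg z ≤ 5π/6`. -/
def arc3 : Set ℂ :=
  {z | ‖z‖ = 1 / √3 ∧ Real.pi / 2 ≤ z.arg ∧ z.arg ≤ 5 * Real.pi / 6}

/-- The part of the fundamental domain of `Γ₀(5)⁺` on the two circles. -/
def arc5 : Set UpperHalfPlane :=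
  fundDomain5 ∩ {z | ‖(z : ℂ)‖ = 1 / √5 ∨ ‖(z : ℂ) + 1 / 2‖ = 1 / (2 * √5)}

end

/-! ### Lattices are determined by their invariants -/

section

namespace PeriodPair

open Filter Topology

/-! A zero `z` of `E` forces a relation between `j(z)` and `j(N z)`, and the fundamental domain has
room for such points only on its lower arcs. For prime `N`, the norm `g(z) ∏_{j<N} g((z+j)/N)` is a
level one form of weight `k(N+1)` with constant term `1` (`FrickeForm.exists_norm_form`). If `g(z) =
0`, it vanishes both at `z` (first factor) and at `N z` (factor `j = 0`). In weights 4, 6, 8, 12 all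
zeros of such a form have the same `j`, so `j(z) = j(N z)`. This settles everything except `k = 4`
with `N = 3` or `5`.

Equality of `j`-invariants gives an `SL₂(ℤ)`-equivalence (`exists_moebius_of_jInv_eq`, through the
fact that `g₂` and `g₃` determine a lattice). Hence `z` is a quadratic point fixed by an integral
matrix of determinant `N`; the inequalities of the domain leave finitely many lower rows, each
checked to lie on the arcs (`normSq_eq_of_jInv_two`, `normSq_eq_of_jInv_three`,
`on_circles_of_jInv_five`).

For `N = 3`, `k = 4` the norm has weight 16 and is `E₄ (E₄³ + dΔ)`; the extra factor `E₄` is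
harmless because `E` is proportional to `E₄(z) + C E₄(3z)`.

For `N = 5`, `k = 4` the norm has weight 24 and is `Δ²` times a monic quadratic in `j`. Two zeros
`p`, `q` of the norm with distinct `j` give both roots, so either `j(z) = j(5z)` or the pair `j(z),
j(5z)` is `j(p), j(q)` in some order (`FrickeForm.jInv_of_zero_five`). Forced zeros at fixed points
supply `p` and `q`, except for the trivial character with `C = 25`: there the intermediate value
theorem gives a zero `p` on `|z| = 1/√5`, and `5p` is equivalent to `-p̄`, so `j(5z) = j(-z̄)`
remains to be treated (`mem_arc5_of_jInv_negConj`). -/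

lemma weierstrassPExcept_zero_ode (L : PeriodPair) :
    ∀ᶠ z in 𝓝 (0 : ℂ), 12 * ℘[L - (0 : ℂ)] z + 4 * z * ℘'[L - (0 : ℂ)] z =
      L.g₂ * z ^ 2 + L.g₃ * z ^ 4 + z ^ 4 * ℘'[L - (0 : ℂ)] z ^ 2
        - 12 * z ^ 2 * ℘[L - (0 : ℂ)] z ^ 2 - 4 * z ^ 4 * ℘[L - (0 : ℂ)] z ^ 3
        + L.g₂ * z ^ 4 * ℘[L - (0 : ℂ)] z := by
  filter_upwards [L.compl_lattice_sdiff_singleton_mem_nhds 0] with z hz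
  by_cases hz0 : z = 0
  · subst hz0; simp
  have hzL : z ∉ L.lattice := by simp_all
  -- Substitute `℘ = h + z⁻²` and `℘' = h' - 2z⁻³` in the cubic equation: the `z⁻⁶` terms cancel,
  -- and multiplying by `z⁴` clears the remaining poles.
  have h := L.derivWeierstrassP_sq z hzL
  have h1 := L.weierstrassPExcept_add (0 : L.lattice) z
  have h2 := L.derivWeierstrassPExcept_sub (0 : L.lattice) z
  simp only [ZeroMemClass.coe_zero, sub_zero] at h1 h2
  rw [← h1, ← h2] at h
  simp at h
  field_simp at h
  have h6 : z ^ 2 ≠ 0 := pow_ne_zero _ hz0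
  apply mul_left_cancel₀ h6
  linear_combination -h

/-- The equation is singular at `0`, but its linear part `12h + 4zh'` multiplies `zⁿ` by `12 + 4n ≠
0`, while the nonlinear terms carry extra powers of `z`. So the lowest term of a difference of
solutions must vanish. -/
lemma analytic_ode_unique {h₁ h₂ d₁ d₂ : ℂ → ℂ} {a b : ℂ}
    (a₁ : AnalyticAt ℂ h₁ 0) (a₂ : AnalyticAt ℂ h₂ 0)
    (e₁ : ∀ᶠ z in 𝓝 (0 : ℂ), HasDerivAt h₁ (d₁ z) z)
    (e₂ : ∀ᶠ z in 𝓝 (0 : ℂ), HasDerivAt h₂ (d₂ z) z)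
    (o₁ : ∀ᶠ z in 𝓝 (0 : ℂ), 12 * h₁ z + 4 * z * d₁ z = a * z ^ 2 + b * z ^ 4 + z ^ 4 * d₁ z ^ 2
        - 12 * z ^ 2 * h₁ z ^ 2 - 4 * z ^ 4 * h₁ z ^ 3 + a * z ^ 4 * h₁ z)
    (o₂ : ∀ᶠ z in 𝓝 (0 : ℂ), 12 * h₂ z + 4 * z * d₂ z = a * z ^ 2 + b * z ^ 4 + z ^ 4 * d₂ z ^ 2
        - 12 * z ^ 2 * h₂ z ^ 2 - 4 * z ^ 4 * h₂ z ^ 3 + a * z ^ 4 * h₂ z) :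
    ∀ᶠ z in 𝓝 (0 : ℂ), h₁ z = h₂ z := by
  by_contra hne
  have ad : AnalyticAt ℂ (fun z => h₁ z - h₂ z) 0 := a₁.sub a₂
  have hfin : analyticOrderAt (fun z => h₁ z - h₂ z) 0 ≠ ⊤ := by
    intro h
    rw [analyticOrderAt_eq_top] at h
    exact hne (h.mono fun z hz => sub_eq_zero.mp hz)
  obtain ⟨g, hg, hg0, hgeq⟩ := (ad.analyticOrderAt_ne_top).mp hfin
  set n := analyticOrderNatAt (fun z => h₁ z - h₂ z) 0
  simp only [sub_zero, smul_eq_mul] at hgeq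
  have hd1 := a₁.deriv.continuousAt
  have hd2 := a₂.deriv.continuousAt
  -- Difference of the two equations with `h₁ - h₂ = zⁿ g`, divided by `zⁿ`. Letting `z → 0` leaves
  -- `(12 + 4n) g(0) = 0`.
  have key : ∀ᶠ z in 𝓝[≠] (0 : ℂ), (12 + 4 * n) * g z + 4 * z * deriv g z =
      z ^ 3 * (deriv h₁ z + deriv h₂ z) * (n * g z + z * deriv g z)
      + z ^ 2 * (-12 * (h₁ z + h₂ z) - 4 * z ^ 2 * (h₁ z ^ 2 + h₁ z * h₂ z + h₂ z ^ 2)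
        + a * z ^ 2) * g z := by
    have hev := hgeq.eventually_nhds
    have hga := hg.eventually_analyticAt
    filter_upwards [self_mem_nhdsWithin, hev.filter_mono nhdsWithin_le_nhds,
      e₁.filter_mono nhdsWithin_le_nhds, e₂.filter_mono nhdsWithin_le_nhds,
      o₁.filter_mono nhdsWithin_le_nhds, o₂.filter_mono nhdsWithin_le_nhds,
      hga.filter_mono nhdsWithin_le_nhds] with z hz hev e1 e2 o1 o2 hga
    have hz : z ≠ 0 := hz
    have hzn : z ^ n ≠ 0 := pow_ne_zero _ hz
    have hgz := hev.self_of_nhds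
    have hder : d₁ z - d₂ z = n * z ^ (n - 1) * g z + z ^ n * deriv g z := by
      have l1 := (e1.sub e2)
      have l2 := ((hasDerivAt_pow n z).mul hga.differentiableAt.hasDerivAt)
      exact l1.unique (l2.congr_of_eventuallyEq hev)
    have hzd : z * (d₁ z - d₂ z) = z ^ n * (n * g z + z * deriv g z) := by
      rw [hder]
      rcases Nat.eq_zero_or_pos n with h0 | h0
      · simp [h0]
      · obtain ⟨m, hm⟩ : ∃ m, n = m + 1 := ⟨n - 1, by omega⟩
        rw [hm]; simp; ring
    rw [e1.deriv, e2.deriv]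
    apply mul_left_cancel₀ hzn
    linear_combination o1 - o2 + (- 4 + z ^ 3 * (d₁ z + d₂ z)) * hzd + (- 12 +
      z ^ 2 * (-12 * (h₁ z + h₂ z) - 4 * z ^ 2 * (h₁ z ^ 2 + h₁ z * h₂ z + h₂ z ^ 2)
        + a * z ^ 2)) * hgz
  have hgd := hg.deriv.continuousAt
  have c1 := a₁.continuousAt
  have c2 := a₂.continuousAt
  have c3 := hg.continuousAt
  have hL : Tendsto (fun z => (12 + 4 * n) * g z + 4 * z * deriv g z) (𝓝[≠] 0)
      (𝓝 ((12 + 4 * n) * g 0 + 4 * 0 * deriv g 0)) :=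
    (show ContinuousAt (fun z => (12 + 4 * n) * g z + 4 * z * deriv g z) 0 by
      fun_prop).tendsto.mono_left nhdsWithin_le_nhds
  have hR : Tendsto (fun z => z ^ 3 * (deriv h₁ z + deriv h₂ z) * (n * g z + z * deriv g z)
      + z ^ 2 * (-12 * (h₁ z + h₂ z) - 4 * z ^ 2 * (h₁ z ^ 2 + h₁ z * h₂ z + h₂ z ^ 2)
        + a * z ^ 2) * g z) (𝓝[≠] 0) (𝓝 _) :=
    (show ContinuousAt (fun z => z ^ 3 * (deriv h₁ z + deriv h₂ z) * (n * g z + z * deriv g z)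
      + z ^ 2 * (-12 * (h₁ z + h₂ z) - 4 * z ^ 2 * (h₁ z ^ 2 + h₁ z * h₂ z + h₂ z ^ 2)
        + a * z ^ 2) * g z) 0 by
      fun_prop).tendsto.mono_left nhdsWithin_le_nhds
  have := tendsto_nhds_unique (hL.congr' key) hR
  simp at this
  rcases this with h | h
  · exact absurd h (by norm_cast; omega)
  · exact hg0 h

lemma weierstrassPExcept_zero_eventuallyEq {L M : PeriodPair} (h2 : L.g₂ = M.g₂)
    (h3 : L.g₃ = M.g₃) : ∀ᶠ z in 𝓝 (0 : ℂ), ℘[L - (0 : ℂ)] z = ℘[M - (0 : ℂ)] z := by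
  have hD : ∀ K : PeriodPair, ∀ᶠ z in 𝓝 (0 : ℂ),
      HasDerivAt ℘[K - (0 : ℂ)] (℘'[K - (0 : ℂ)] z) z := by
    intro K
    have ho : IsOpen (K.lattice \ {(0 : ℂ)} : Set ℂ)ᶜ := K.isOpen_compl_lattice_sdiff
    filter_upwards [K.compl_lattice_sdiff_singleton_mem_nhds 0] with z hz
    rw [← K.eqOn_deriv_weierstrassPExcept_derivWeierstrassPExcept 0 hz]
    exact ((K.differentiableOn_weierstrassPExcept 0).differentiableAt (ho.mem_nhds hz)).hasDerivAt
  refine analytic_ode_unique (L.analyticAt_weierstrassPExcept 0) (M.analyticAt_weierstrassPExcept 0)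
    (hD L) (hD M) L.weierstrassPExcept_zero_ode ?_
  rw [h2, h3]
  exact M.weierstrassPExcept_zero_ode

/-- The two `℘`-functions agree near `0`, hence on the complement of both lattices, which is
connected because a countable set was removed. A point of `L` outside `M` would be a pole of one and
a regular point of the other. -/
lemma lattice_le_of_invariants {L M : PeriodPair} (h2 : L.g₂ = M.g₂)
    (h3 : L.g₃ = M.g₃) : L.lattice ≤ M.lattice := by
  have hnear := weierstrassPExcept_zero_eventuallyEq h2 h3
  set U : Set ℂ := ((L.lattice : Set ℂ) ∪ M.lattice)ᶜ with hU
  have hcount : ((L.lattice : Set ℂ) ∪ M.lattice).Countable := by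
    apply Set.Countable.union
    · exact Set.countable_coe_iff.mp (inferInstanceAs (Countable L.lattice))
    · exact Set.countable_coe_iff.mp (inferInstanceAs (Countable M.lattice))
  have hUo : IsOpen U := (L.isClosed_lattice.union M.isClosed_lattice).isOpen_compl
  have hUc : IsPreconnected U :=
    (hcount.isPathConnected_compl_of_one_lt_rank (by simp)).isConnected.isPreconnected
  have aL : AnalyticOnNhd ℂ ℘[L] U := L.analyticOnNhd_weierstrassP.mono
    (Set.compl_subset_compl.mpr Set.subset_union_left)
  have aM : AnalyticOnNhd ℂ ℘[M] U := M.analyticOnNhd_weierstrassP.mono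
    (Set.compl_subset_compl.mpr Set.subset_union_right)
  have hdense : Dense U := hcount.dense_compl ℝ
  have hn2 : ∀ᶠ z in 𝓝 (0 : ℂ), ℘[L] z = ℘[M] z := by
    filter_upwards [hnear] with z hz
    have l1 := L.weierstrassPExcept_add (0 : L.lattice) z
    have l2 := M.weierstrassPExcept_add (0 : M.lattice) z
    simp only [ZeroMemClass.coe_zero] at l1 l2
    rw [← l1, ← l2, hz]
  obtain ⟨z₀, hz₀U, hz₀⟩ : ∃ z₀ ∈ U, ∀ᶠ z in 𝓝 z₀, ℘[L] z = ℘[M] z := by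
    obtain ⟨V, hV, hVo, h0V⟩ := eventually_nhds_iff.mp hn2
    obtain ⟨z₀, h1, h2⟩ := hdense.inter_open_nonempty V hVo ⟨0, h0V⟩
    exact ⟨z₀, h2, eventually_nhds_iff.mpr ⟨V, hV, hVo, h1⟩⟩
  have hEq : Set.EqOn ℘[L] ℘[M] U := aL.eqOn_of_preconnected_of_eventuallyEq aM hUc hz₀U hz₀
  intro l hl
  by_contra hlM
  have ho := L.order_weierstrassP l hl
  have hpun : ℘[L] =ᶠ[𝓝[≠] l] ℘[M] := by
    filter_upwards [self_mem_nhdsWithin, mem_nhdsWithin_of_mem_nhds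
      (L.compl_lattice_sdiff_singleton_mem_nhds l), mem_nhdsWithin_of_mem_nhds
      (M.compl_lattice_sdiff_singleton_mem_nhds l)] with z h1 h2 h3
    apply hEq
    simp_all
  rw [meromorphicOrderAt_congr hpun] at ho
  have := (M.analyticOnNhd_weierstrassP l hlM).meromorphicOrderAt_nonneg
  rw [ho] at this
  exact absurd this (by decide)

theorem lattice_eq_of_invariants {L M : PeriodPair} (h2 : L.g₂ = M.g₂)
    (h3 : L.g₃ = M.g₃) : L.lattice = M.lattice :=
  le_antisymm (lattice_le_of_invariants h2 h3) (lattice_le_of_invariants h2.symm h3.symm)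

end PeriodPair

end

/-! ### The `j`-invariant separates orbits -/

section

open UpperHalfPlane ModularForm EisensteinSeries Complex

/-- The lattice `ℤ μz + ℤ μ`. -/
def scaledPeriods (μ : ℂ) (hμ : μ ≠ 0) (z : ℍ) : PeriodPair where
  ω₁ := μ * z
  ω₂ := μ
  indep := by
    rw [LinearIndependent.pair_iff]
    intro s t h
    have h' : μ * ((s : ℂ) * z + t) = 0 := by
      simp only [real_smul] at h
      linear_combination h
    have h1 := (mul_eq_zero.mp h').resolve_left hμ
    have him := congrArg Complex.im h1
    have hre := congrArg Complex.re h1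
    simp [z.im_ne_zero] at him
    simp [him] at hre
    exact ⟨him, hre⟩

lemma mem_scaledPeriods_lattice {μ : ℂ} {hμ : μ ≠ 0} {z : ℍ} {x : ℂ} :
    x ∈ (scaledPeriods μ hμ z).lattice ↔ ∃ m n : ℤ, μ * (m * z + n) = x := by
  rw [PeriodPair.mem_lattice]
  simp only [scaledPeriods]
  exact exists₂_congr fun m n => by rw [mul_add]; constructor <;> rintro rfl <;> ring

lemma scaledPeriods_G (μ : ℂ) (hμ : μ ≠ 0) (z : ℍ) {k : ℕ} (hk : 3 ≤ k) :
    (scaledPeriods μ hμ z).G k = 2 * riemannZeta k * (μ ^ k)⁻¹ * E hk z := by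
  have h1 := tsum_eisSummand_eq_riemannZeta_mul_eisensteinSeries hk z
  have h2 : E hk z = 1 / 2 * eisensteinSeries (N := 1) 0 k z := by
    rw [show E hk z = (1 / 2 : ℂ) • eisensteinSeriesSIF (N := 1) 0 k z from rfl,
      eisensteinSeriesSIF_apply 0 k z, smul_eq_mul]
  rw [h2, PeriodPair.G, ← (scaledPeriods μ hμ z).latticeEquivProd.symm.toEquiv.tsum_eq,
    ← (finTwoArrowEquiv ℤ).tsum_eq]
  have h3 : ∀ v : Fin 2 → ℤ, ((((scaledPeriods μ hμ z).latticeEquivProd.symm.toEquiv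
      (finTwoArrowEquiv ℤ v) : (scaledPeriods μ hμ z).lattice) : ℂ) ^ k)⁻¹ =
      (μ ^ k)⁻¹ * eisSummand k v z := by
    intro v
    have : (((scaledPeriods μ hμ z).latticeEquivProd.symm.toEquiv
      (finTwoArrowEquiv ℤ v) : (scaledPeriods μ hμ z).lattice) : ℂ) = μ * (v 0 * z + v 1) := by
      refine ((scaledPeriods μ hμ z).latticeEquiv_symm_apply _).trans ?_
      simp [scaledPeriods]
      ring
    rw [this, eisSummand, mul_pow, mul_inv, zpow_neg, zpow_natCast]
  rw [tsum_congr h3, tsum_mul_left, h1]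
  ring

/-- `E₄³ / Δ`. -/
noncomputable def jInv (z : ℍ) : ℂ := E₄ z ^ 3 / discriminant z

/-- Take `μ¹² = Δ(w)/Δ(z)`. Then `E₄` matches up to a cube root of unity `ω` and `E₆` up to sign.
Since `ω⁴ = ω`, `ω⁶ = 1`, `i⁴ = 1`, `i⁶ = -1`, replacing `μ` by `ωμ` or `ωiμ` corrects each
independently. -/
lemma exists_scale_of_jInv_eq {z w : ℍ} (h : jInv z = jInv w) :
    ∃ μ : ℂ, μ ≠ 0 ∧ E₄ w = μ ^ 4 * E₄ z ∧ E₆ w = μ ^ 6 * E₆ z := by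
  have hz := discriminant_ne_zero z
  have hw := discriminant_ne_zero w
  obtain ⟨μ, hμ⟩ := IsAlgClosed.exists_pow_nat_eq (discriminant w / discriminant z)
    (show 0 < 12 by norm_num)
  have hμ0 : μ ≠ 0 := by
    rintro rfl
    rw [zero_pow (by norm_num), eq_comm] at hμ
    exact div_ne_zero hw hz hμ
  have hμ' : discriminant w = μ ^ 12 * discriminant z := by rw [hμ]; field_simp
  have e4 : E₄ w ^ 3 = (μ ^ 4 * E₄ z) ^ 3 := by
    unfold jInv at h
    rw [div_eq_div_iff hz hw, hμ'] at h
    apply mul_right_cancel₀ hz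
    linear_combination -h
  have e6 : E₆ w ^ 2 = (μ ^ 6 * E₆ z) ^ 2 := by
    have d1 := discriminant_eq_E₄_cube_sub_E₆_sq z
    have d2 := discriminant_eq_E₄_cube_sub_E₆_sq w
    rw [hμ', d1] at d2
    linear_combination e4 + 1728 * d2
  obtain ⟨ω, hω, hω4⟩ : ∃ ω : ℂ, ω ^ 3 = 1 ∧ E₄ w = ω * (μ ^ 4 * E₄ z) := by
    by_cases h0 : μ ^ 4 * E₄ z = 0
    · exact ⟨1, one_pow 3, by rw [h0] at e4 ⊢; simpa using e4⟩
    · refine ⟨E₄ w / (μ ^ 4 * E₄ z), ?_, (div_mul_cancel₀ _ h0).symm⟩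
      rw [div_pow, e4, div_self (pow_ne_zero 3 h0)]
  have hω0 : ω ≠ 0 := by rintro rfl; norm_num at hω
  rcases sq_eq_sq_iff_eq_or_eq_neg.mp e6 with h6 | h6
  · refine ⟨ω * μ, mul_ne_zero hω0 hμ0, ?_, ?_⟩
    · rw [hω4]; linear_combination -(ω * μ ^ 4 * E₄ z) * hω
    · rw [h6]; linear_combination -((ω ^ 3 + 1) * μ ^ 6 * E₆ z) * hω
  · have I2 : Complex.I ^ 2 = -1 := I_sq
    refine ⟨ω * Complex.I * μ, mul_ne_zero (mul_ne_zero hω0 I_ne_zero) hμ0, ?_, ?_⟩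
    · rw [hω4, mul_pow, mul_pow, show Complex.I ^ 4 = 1 from I_pow_four]
      linear_combination -(ω * μ ^ 4 * E₄ z) * hω
    · rw [h6, mul_pow, mul_pow, show Complex.I ^ 6 = -1 by rw [show 6 = 2 * 3 by rfl, pow_mul, I2]; norm_num]
      linear_combination ((ω ^ 3 + 1) * μ ^ 6 * E₆ z) * hω

/-- The `j`-invariant separates orbits of the modular group. -/
theorem exists_moebius_of_jInv_eq {z w : ℍ} (h : jInv z = jInv w) :
    ∃ a b c d : ℤ, a * d - b * c = 1 ∧ (w : ℂ) * (c * z + d) = a * z + b := by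
  obtain ⟨μ, hμ, h4, h6⟩ := exists_scale_of_jInv_eq h
  have hlat : (scaledPeriods 1 one_ne_zero w).lattice =
      (scaledPeriods μ⁻¹ (inv_ne_zero hμ) z).lattice := by
    have g4 := scaledPeriods_G 1 one_ne_zero w (k := 4) (by norm_num)
    have g4' := scaledPeriods_G μ⁻¹ (inv_ne_zero hμ) z (k := 4) (by norm_num)
    have g6 := scaledPeriods_G 1 one_ne_zero w (k := 6) (by norm_num)
    have g6' := scaledPeriods_G μ⁻¹ (inv_ne_zero hμ) z (k := 6) (by norm_num)
    apply PeriodPair.lattice_eq_of_invariants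
    · rw [PeriodPair.g₂, PeriodPair.g₂, g4, g4', h4]; simp; ring
    · rw [PeriodPair.g₃, PeriodPair.g₃, g6, g6', h6]; simp; ring
  have m1 : (w : ℂ) ∈ (scaledPeriods 1 one_ne_zero w).lattice :=
    mem_scaledPeriods_lattice.mpr ⟨1, 0, by simp⟩
  have m2 : (1 : ℂ) ∈ (scaledPeriods 1 one_ne_zero w).lattice :=
    mem_scaledPeriods_lattice.mpr ⟨0, 1, by simp⟩
  have m3 : μ⁻¹ * z ∈ (scaledPeriods μ⁻¹ (inv_ne_zero hμ) z).lattice :=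
    mem_scaledPeriods_lattice.mpr ⟨1, 0, by simp⟩
  have m4 : μ⁻¹ ∈ (scaledPeriods μ⁻¹ (inv_ne_zero hμ) z).lattice :=
    mem_scaledPeriods_lattice.mpr ⟨0, 1, by simp⟩
  rw [hlat] at m1 m2
  rw [← hlat] at m3 m4
  obtain ⟨a, b, hab⟩ := mem_scaledPeriods_lattice.mp m1
  obtain ⟨c, d, hcd⟩ := mem_scaledPeriods_lattice.mp m2
  obtain ⟨p, q, hpq⟩ := mem_scaledPeriods_lattice.mp m3
  obtain ⟨r, s, hrs⟩ := mem_scaledPeriods_lattice.mp m4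
  have hab' : (w : ℂ) * μ = a * z + b := by rw [← hab]; field_simp
  have hcd' : μ = c * z + d := by
    have := congrArg (μ * ·) hcd
    simp only [mul_one] at this
    rw [← this]; field_simp
  have hpq' : (z : ℂ) = μ * (p * w + q) := by
    rw [one_mul] at hpq; rw [hpq]; field_simp
  have hrs' : 1 = μ * (r * w + s) := by
    rw [one_mul] at hrs; rw [hrs]; field_simp
  have hwz : (w : ℂ) * (c * z + d) = a * z + b := by rw [← hcd', hab']
  have ind : ∀ x y : ℤ, (x : ℂ) * z + y = 0 → x = 0 ∧ y = 0 := by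
    intro x y hxy
    have him := congrArg Complex.im hxy
    have hre := congrArg Complex.re hxy
    simp [z.im_ne_zero] at him
    simp [him] at hre
    exact ⟨him, hre⟩
  obtain ⟨e1, e2⟩ := ind (p * a + q * c - 1) (p * b + q * d) (by
    push_cast
    linear_combination -(p : ℂ) * hab' - q * hcd' - hpq')
  obtain ⟨e3, e4⟩ := ind (r * a + s * c) (r * b + s * d - 1) (by
    push_cast
    linear_combination -(r : ℂ) * hab' - s * hcd' - hrs')
  -- The two integral base changes are mutually inverse, so the determinant is `±1`; positivity of
  -- both imaginary parts then selects `+1`.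
  have hdet : (a * d - b * c) * (p * s - q * r) = 1 := by
    have e1' : p * a + q * c = 1 := by omega
    have e4' : r * b + s * d = 1 := by omega
    linear_combination (r * b + s * d) * e1' + e4' - (r * a + s * c) * e2
  have hpos : 0 < a * d - b * c := by
    have hn : 0 < normSq ((c : ℂ) * z + d) := by
      rw [Complex.normSq_pos, ← hcd']; exact hμ
    have hA : (a * d - b * c : ℝ) * z.im = w.im * normSq ((c : ℂ) * z + d) := by
      have hre := congrArg Complex.re hwz
      have him := congrArg Complex.im hwz
      simp at hre him
      rw [normSq_apply]
      simp
      linear_combination -(c * z.re + d) * him + (c * z.im) * hre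
    have : 0 < (a * d - b * c : ℝ) * z.im := hA ▸ mul_pos w.im_pos hn
    have := pos_of_mul_pos_left this z.im_pos.le
    exact_mod_cast this
  refine ⟨a, b, c, d, ?_, hwz⟩
  rcases Int.mul_eq_one_iff_eq_one_or_neg_one.mp hdet with ⟨h, _⟩ | ⟨h, _⟩ <;> omega

end

/-! ### Level one forms -/

section

open UpperHalfPlane ModularForm EisensteinSeries Complex

open Filter Topology

lemma levelOne_moebius {k : ℤ} (F : ModularForm 𝒮ℒ k) {a b c d : ℤ} (h : a * d - b * c = 1)
    {z w : ℍ} (hw : (w : ℂ) * (c * z + d) = a * z + b) :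
    F w = ((c : ℂ) * z + d) ^ k * F z := by
  let γ : SL(2, ℤ) := ⟨!![a, b; c, d], by rw [Matrix.det_fin_two_of]; exact h⟩
  have hden : denom γ z = (c : ℂ) * z + d :=
    (ModularGroup.denom_apply γ z).trans (by simp [γ])
  have hd0 : (c : ℂ) * z + d ≠ 0 := hden ▸ denom_ne_zero γ z
  have hγ : γ • z = w := by
    apply UpperHalfPlane.ext
    rw [coe_specialLinearGroup_apply]
    simp [γ]
    rw [div_eq_iff hd0, hw]
  have h1 : (F : ℍ → ℂ) ∣[k] γ = F :=
    SlashInvariantFormClass.slash_action_eq F _ (MonoidHom.mem_range.mpr ⟨γ, rfl⟩)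
  have h2 := congrFun h1 z
  rw [SL_slash_apply, hγ, hden, zpow_neg] at h2
  rw [← h2]
  field_simp

lemma discriminant_moebius {a b c d : ℤ} (h : a * d - b * c = 1)
    {z w : ℍ} (hw : (w : ℂ) * (c * z + d) = a * z + b) :
    discriminant w = ((c : ℂ) * z + d) ^ 12 * discriminant z := by
  rw [discriminant_eq_E₄_cube_sub_E₆_sq, discriminant_eq_E₄_cube_sub_E₆_sq,
    levelOne_moebius E₄ h hw, levelOne_moebius E₆ h hw]
  norm_cast
  ring

lemma jInv_moebius {a b c d : ℤ} (h : a * d - b * c = 1)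
    {z w : ℍ} (hw : (w : ℂ) * (c * z + d) = a * z + b) : jInv w = jInv z := by
  have hΔ := discriminant_moebius h hw
  have hw0 := discriminant_ne_zero w
  have hz0 := discriminant_ne_zero z
  have h4 : E₄ w = ((c : ℂ) * z + d) ^ 4 * E₄ z := by
    have := levelOne_moebius E₄ h hw
    exact_mod_cast this
  unfold jInv
  rw [div_eq_div_iff hw0 hz0, hΔ, h4]
  ring

/-- A level one form with constant term `1`, given by its values. -/
lemma exists_levelOne_form {w : ℕ} {G : ℂ → ℂ} (hd : DifferentiableOn ℂ G {z | 0 < z.im})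
    (hT : ∀ z, 0 < z.im → G (z + 1) = G z) (hS : ∀ z, 0 < z.im → G (-1 / z) = z ^ w * G z)
    (hG : Tendsto G (comap Complex.im atTop) (𝓝 1)) :
    ∃ F : ModularForm 𝒮ℒ w, (∀ z : ℍ, F z = G z) ∧ (qExpansion 1 F).coeff 0 = 1 := by
  have hTs : (fun z : ℍ => G z) ∣[(w : ℤ)] ModularGroup.T = fun z : ℍ => G z := by
    ext z
    rw [SL_slash_apply, modular_T_smul]
    have : denom ModularGroup.T z = 1 :=
      (ModularGroup.denom_apply _ z).trans (by simp [ModularGroup.T])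
    rw [this]
    simp only [one_zpow, mul_one, coe_vadd]
    rw [← hT z z.im_pos, add_comm]; simp
  have hSs : (fun z : ℍ => G z) ∣[(w : ℤ)] ModularGroup.S = fun z : ℍ => G z := by
    ext z
    rw [SlashInvariantForm.slash_S_apply]
    have h := hS z z.im_pos
    simp only
    rw [inv_neg, ← one_div, ← neg_div, h, zpow_neg, zpow_natCast]
    field_simp [z.ne_zero]
  have hinv := SlashInvariantForm.slash_action_generators_SL2Z hSs hTs
  have hlim : Tendsto (fun z : ℍ => G z) atImInfty (𝓝 1) := hG.comp tendsto_coe_atImInfty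
  let F : ModularForm 𝒮ℒ w :=
    { toFun := fun z => G z
      slash_action_eq' := by rintro _ ⟨γ, rfl⟩; exact hinv γ
      holo' := by
        refine UpperHalfPlane.mdifferentiable_iff.mpr ?_
        refine hd.congr fun z hz => ?_
        change G (ofComplex z) = G z
        rw [ofComplex_apply_of_im_pos hz]
      -- All cusps are equivalent under `SL₂(ℤ)`, so invariance reduces boundedness to the limit at
      -- `∞`.
      bdd_at_cusps' := by
        intro c hc
        rw [OnePoint.isBoundedAt_iff_forall_SL2Z hc]
        intro γ _
        rw [hinv γ]
        exact hlim.isBigO_one ℝ }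
  refine ⟨F, fun z => rfl, ?_⟩
  rw [qExpansion_coeff_zero one_pos
    (ModularFormClass.analyticAt_cuspFunction_zero F one_pos one_mem_strictPeriods_SL)
    (SlashInvariantFormClass.periodic_comp_ofComplex F one_mem_strictPeriods_SL)]
  exact hlim.limUnder_eq

/-! ### Level one forms of small weight by division by the discriminant -/

lemma coeff_zero_mul {k l : ℤ} (F : ModularForm 𝒮ℒ k) (H : ModularForm 𝒮ℒ l) :
    (qExpansion 1 (F.mul H)).coeff 0 = (qExpansion 1 F).coeff 0 * (qExpansion 1 H).coeff 0 := by
  rw [ModularForm.qExpansion_mul one_pos one_mem_strictPeriods_SL]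
  simp

lemma coeff_zero_E₄ : (qExpansion 1 E₄).coeff 0 = 1 := E_qExpansion_coeff_zero _ ⟨2, rfl⟩

lemma coeff_zero_E₆ : (qExpansion 1 E₆).coeff 0 = 1 := E_qExpansion_coeff_zero _ ⟨3, rfl⟩

/-- Removing the constant term of a level one form. -/
lemma exists_eq_add_discriminant_mul {k : ℤ} (F P : ModularForm 𝒮ℒ k)
    (hP : (qExpansion 1 P).coeff 0 = 1) :
    ∃ H : ModularForm 𝒮ℒ (k - 12),
      ∀ z, F z = (qExpansion 1 F).coeff 0 * P z + discriminant z * H z := by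
  set c := (qExpansion 1 F).coeff 0
  have h0 : (qExpansion 1 (F - c • P : ModularForm 𝒮ℒ k)).coeff 0 = 0 := by
    rw [FunLike.coe_sub, FunLike.coe_smul,
      ← FunLike.coe_smul, ModularForm.qExpansion_sub one_pos one_mem_strictPeriods_SL F (c • P),
      FunLike.coe_smul, ModularForm.qExpansion_smul one_pos one_mem_strictPeriods_SL,
      map_sub, PowerSeries.coeff_smul, hP]
    simp [c]
  refine ⟨CuspForm.discriminantEquiv (toCuspForm (F - c • P) h0), fun z => ?_⟩
  rw [discriminant_mul_discriminantEquiv_apply, toCuspForm_apply]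
  simp

lemma levelOne_weight_zero_apply {k : ℤ} (hk : k = 0) (F : ModularForm 𝒮ℒ k) :
    ∃ c : ℂ, ∀ z, F z = c := by
  subst hk
  obtain ⟨c, hc⟩ := ModularFormClass.levelOne_weight_zero_const F
  exact ⟨c, fun z => by rw [hc]; rfl⟩

lemma levelOne_neg_weight_apply {k : ℤ} (hk : k < 0) (F : ModularForm 𝒮ℒ k) (z : ℍ) :
    F z = 0 := by
  rw [ModularFormClass.levelOne_neg_weight_eq_zero hk F]; rfl

lemma levelOne_weight_four {k : ℤ} (hk : k = 4) (F : ModularForm 𝒮ℒ k) :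
    ∃ c : ℂ, ∀ z, F z = c * E₄ z := by
  subst hk
  obtain ⟨H, hH⟩ := exists_eq_add_discriminant_mul F E₄ coeff_zero_E₄
  exact ⟨_, fun z => by rw [hH z, levelOne_neg_weight_apply (by norm_num) H]; ring⟩

lemma levelOne_weight_twelve {k : ℤ} (hk : k = 12) (F : ModularForm 𝒮ℒ k) :
    ∃ d : ℂ, ∀ z, F z = (qExpansion 1 F).coeff 0 * E₄ z ^ 3 + d * discriminant z := by
  subst hk
  obtain ⟨H, hH⟩ := exists_eq_add_discriminant_mul F (((E₄.mul E₄).mul E₄).mcast (by norm_num))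
    (by rw [coe_mcast, coeff_zero_mul, coeff_zero_mul, coeff_zero_E₄]; norm_num)
  obtain ⟨d, hd⟩ := levelOne_weight_zero_apply (by norm_num) H
  refine ⟨d, fun z => ?_⟩
  rw [hH z, hd z, mcast_apply, ModularForm.coe_mul, ModularForm.coe_mul]
  simp only [Pi.mul_apply]
  ring

lemma jInv_eq_zero_iff {z : ℍ} : jInv z = 0 ↔ E₄ z = 0 := by
  simp [jInv, discriminant_ne_zero]

lemma jInv_eq_of_E₆_eq_zero {z : ℍ} (h : E₆ z = 0) : jInv z = 1728 := by
  have h1 := discriminant_eq_E₄_cube_sub_E₆_sq z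
  rw [jInv, div_eq_iff (discriminant_ne_zero z), h1, h]
  ring

lemma add_mul_discriminant_eq_zero_iff {z : ℍ} {d : ℂ} :
    E₄ z ^ 3 + d * discriminant z = 0 ↔ jInv z = -d := by
  rw [jInv, div_eq_iff (discriminant_ne_zero z)]
  constructor <;> intro h <;> linear_combination h

/-- In weights `4`, `6`, `8` and `12` all zeros of a level one form are equivalent. -/
lemma jInv_eq_of_levelOne_zero {w : ℕ} (hw : w = 4 ∨ w = 6 ∨ w = 8 ∨ w = 12)
    (F : ModularForm 𝒮ℒ w) (h1 : (qExpansion 1 F).coeff 0 = 1) {z z' : ℍ}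
    (hz : F z = 0) (hz' : F z' = 0) : jInv z = jInv z' := by
  rcases hw with rfl | rfl | rfl | rfl
  · obtain ⟨H, hH⟩ := exists_eq_add_discriminant_mul F (E₄.mcast (by norm_num))
      (by rw [coe_mcast, coeff_zero_E₄])
    have key : ∀ z, F z = E₄ z := fun z => by
      rw [hH z, levelOne_neg_weight_apply (by norm_num) H, h1, mcast_apply]; ring
    rw [key] at hz hz'
    rw [jInv_eq_zero_iff.mpr hz, jInv_eq_zero_iff.mpr hz']
  · obtain ⟨H, hH⟩ := exists_eq_add_discriminant_mul F (E₆.mcast (by norm_num))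
      (by rw [coe_mcast, coeff_zero_E₆])
    have key : ∀ z, F z = E₆ z := fun z => by
      rw [hH z, levelOne_neg_weight_apply (by norm_num) H, h1, mcast_apply]; ring
    rw [key] at hz hz'
    rw [jInv_eq_of_E₆_eq_zero hz, jInv_eq_of_E₆_eq_zero hz']
  · obtain ⟨H, hH⟩ := exists_eq_add_discriminant_mul F ((E₄.mul E₄).mcast (by norm_num))
      (by rw [coe_mcast, coeff_zero_mul, coeff_zero_E₄]; norm_num)
    have key : ∀ z, F z = E₄ z * E₄ z := fun z => by
      rw [hH z, levelOne_neg_weight_apply (by norm_num) H, h1, mcast_apply, ModularForm.coe_mul]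
      simp
    rw [key] at hz hz'
    rw [jInv_eq_zero_iff.mpr (mul_self_eq_zero.mp hz), jInv_eq_zero_iff.mpr
      (mul_self_eq_zero.mp hz')]
  -- Here `F = E₄³ + dΔ`, and `F/Δ = j + d` has a single root in `j`.
  · obtain ⟨d, hd⟩ := levelOne_weight_twelve (by norm_num) F
    rw [hd, h1, one_mul, add_mul_discriminant_eq_zero_iff] at hz hz'
    rw [hz, hz']

/-- Subtracting `E₄⁴` and dividing by `Δ` leaves weight 4, a multiple of `E₄`; hence `F` factors as
`E₄` times a form of weight 12. -/
lemma levelOne_weight_sixteen_zero (F : ModularForm 𝒮ℒ ((16 : ℕ) : ℤ))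
    (h1 : (qExpansion 1 F).coeff 0 = 1) :
    ∃ d : ℂ, ∀ z, F z = 0 → E₄ z = 0 ∨ jInv z = d := by
  obtain ⟨H, hH⟩ := exists_eq_add_discriminant_mul F
    ((((E₄.mul E₄).mul E₄).mul E₄).mcast (by norm_num))
    (by rw [coe_mcast, coeff_zero_mul, coeff_zero_mul, coeff_zero_mul, coeff_zero_E₄]; norm_num)
  obtain ⟨d, hd⟩ := levelOne_weight_four (by norm_num) H
  refine ⟨-d, fun z hz => ?_⟩
  rw [← add_mul_discriminant_eq_zero_iff, ← mul_eq_zero, ← hz, hH z, hd z, h1, mcast_apply]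
  simp only [ModularForm.coe_mul, Pi.mul_apply]
  ring

/-- `F = E₄⁶ + Δ(c E₄³ + eΔ)`, so `F/Δ²` is a monic quadratic in `j`. -/
lemma levelOne_weight_twentyfour_zero (F : ModularForm 𝒮ℒ ((24 : ℕ) : ℤ))
    (h1 : (qExpansion 1 F).coeff 0 = 1) :
    ∃ d e : ℂ, ∀ z, F z = 0 → jInv z ^ 2 + d * jInv z + e = 0 := by
  obtain ⟨H, hH⟩ := exists_eq_add_discriminant_mul F
    ((((E₄.mul E₄).mul E₄).mul ((E₄.mul E₄).mul E₄)).mcast (by norm_num))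
    (by rw [coe_mcast]; simp only [coeff_zero_mul, coeff_zero_E₄]; norm_num)
  obtain ⟨e, he⟩ := levelOne_weight_twelve (by norm_num) H
  refine ⟨(qExpansion 1 H).coeff 0, e, fun z hz => ?_⟩
  have hΔ := discriminant_ne_zero z
  have h2 := hH z
  rw [he z, hz, h1, mcast_apply] at h2
  simp only [ModularForm.coe_mul, Pi.mul_apply] at h2
  rw [jInv]
  generalize (qExpansion 1 H).coeff 0 = c at h2 ⊢
  field_simp
  linear_combination -h2

end

/-! ### The Fricke functional equation -/

section

open UpperHalfPlane ModularForm EisensteinSeries Complex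

open Filter Topology

/-- A holomorphic function transforming under `Γ₀(N)` with character `χ₀` and under the Fricke
involution `z ↦ -1 / (N z)`, with constant term `1`. -/
structure FrickeForm (N k : ℕ) (χ₀ : DirichletCharacter ℂ N) (C : ℂ) (g : ℂ → ℂ) : Prop where
  diff : DifferentiableOn ℂ g {z | 0 < z.im}
  gamma : ∀ a b c d : ℤ, a * d - b * (N * c) = 1 → ∀ z : ℂ, 0 < z.im →
    g ((a * z + b) / (N * c * z + d)) = χ₀ (d : ZMod N) * (N * c * z + d) ^ k * g z
  fricke : ∀ z : ℂ, 0 < z.im → g (-1 / (N * z)) = C * z ^ k * g z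
  sq_eq : C ^ 2 = (-1) ^ k * N ^ k
  tendsto : Tendsto g (comap Complex.im atTop) (𝓝 1)

lemma im_neg_inv_pos {z : ℂ} (hz : 0 < z.im) : 0 < (-1 / z).im := by
  have h0 : z ≠ 0 := by rintro rfl; simp at hz
  have : -1 / z = -z⁻¹ := by field_simp
  rw [this, neg_im, inv_im]
  have := Complex.normSq_pos.mpr h0
  rw [neg_div, neg_neg]
  positivity

lemma im_natMul_pos {n : ℕ} (hn : 0 < n) {z : ℂ} (hz : 0 < z.im) : 0 < ((n : ℂ) * z).im := by
  rw [Complex.mul_im]; simp; positivity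

lemma im_add_div_pos {n : ℕ} (hn : 0 < n) {z : ℂ} (hz : 0 < z.im) (j : ℕ) :
    0 < ((z + j) / n).im := by
  rw [div_natCast_im]; simp; positivity

/-- The matrix `(0, -1; N, 0)` gives the Fricke equation. It squares to the scalar `-N`, so applying
the equation twice at a point where `f ≠ 0` determines `C²`; only the sign of `C` depends on `χ`. -/
lemma fricke_of_modular {N k : ℕ} (hN : 0 < N) {χ₀ : DirichletCharacter ℂ N}
    {χ : Gamma0Plus N →* ℂˣ} (hχ : RestrictsTo χ χ₀) {f : ℍ → ℂ}
    (hf : IsModularFormPlus N k χ f) (h1 : Tendsto f atImInfty (𝓝 1)) :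
    ∃ C, FrickeForm N k χ₀ C (f ∘ ofComplex) := by
  have hN' : (N : ℂ) ≠ 0 := by exact_mod_cast hN.ne'
  have hNR : (N : ℝ) ≠ 0 := by exact_mod_cast hN.ne'
  have hlim : Tendsto (f ∘ ofComplex) (comap Complex.im atTop) (𝓝 1) :=
    h1.comp tendsto_comap_im_ofComplex
  obtain ⟨C, hC⟩ : ∃ C : ℂ, ∀ z : ℂ, 0 < z.im →
      (f ∘ ofComplex) (-1 / (N * z)) = C * z ^ k * (f ∘ ofComplex) z := by
    have hdet : (!![0, -1; (N : ℝ), 0] : Matrix (Fin 2) (Fin 2) ℝ).det ≠ 0 := by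
      rw [Matrix.det_fin_two_of]; simpa using hN.ne'
    let W : GL (Fin 2) ℝ := Matrix.GeneralLinearGroup.mkOfDetNeZero _ hdet
    have hW : W ∈ Gamma0Plus N := by
      refine Subgroup.subset_closure (Or.inr ⟨N, hN, dvd_rfl, 0, -1, 1, 0, by ring, ?_⟩)
      simp [W, Matrix.GeneralLinearGroup.mkOfDetNeZero]
    have hdetW : (W.det : ℝ) = N := by
      simp [W, Matrix.GeneralLinearGroup.mkOfDetNeZero, Matrix.det_fin_two_of]
    set P : ℂ := ((((W.det : ℝˣ) : ℝ) ^ ((k : ℝ) / 2) : ℝ) : ℂ) with hP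
    have hP0 : P ≠ 0 := by
      rw [hP, hdetW]
      exact_mod_cast (Real.rpow_pos_of_pos (by positivity) _).ne'
    refine ⟨χ ⟨W, hW⟩ * P⁻¹ * N ^ k, fun z hz => ?_⟩
    have h := hf.slash_eq ⟨W, hW⟩ ⟨z, hz⟩
    unfold normSlash at h
    have hden : denom W ((⟨z, hz⟩ : ℍ) : ℂ) = N * z := by
      simp [denom, W, Matrix.GeneralLinearGroup.mkOfDetNeZero]
    have hz0 : z ≠ 0 := by rintro rfl; simp at hz
    have hsm : W • (⟨z, hz⟩ : ℍ) = ofComplex (-1 / (N * z)) := by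
      apply UpperHalfPlane.ext
      rw [coe_smul_of_det_pos (by rw [hdetW]; positivity), hden,
        ofComplex_apply_of_im_pos (im_neg_inv_pos (im_natMul_pos hN hz))]
      simp [num, W, Matrix.GeneralLinearGroup.mkOfDetNeZero]
    simp only [hsm, hden] at h
    rw [← hP] at h
    simp only [Function.comp_apply, ofComplex_apply_of_im_pos hz]
    have hk0 : (N * z) ^ k ≠ 0 := pow_ne_zero _ (mul_ne_zero hN' hz0)
    field_simp at h ⊢
    rw [h]; ring
  refine ⟨C, UpperHalfPlane.mdifferentiable_iff.mp hf.holo, ?_, hC, ?_, hlim⟩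
  · intro a b c d hdet z hz
    let γ : SL(2, ℤ) := ⟨!![a, b; N * c, d], by rw [Matrix.det_fin_two_of]; exact hdet⟩
    have hγ : γ ∈ CongruenceSubgroup.Gamma0 N := by
      rw [CongruenceSubgroup.Gamma0_mem]; simp [γ]
    have h := hf.slash_eq ⟨_, mapGL_mem_Gamma0Plus hγ⟩ ⟨z, hz⟩
    rw [hχ γ hγ] at h
    unfold normSlash at h
    have hden : denom (Matrix.SpecialLinearGroup.mapGL ℝ γ) ((⟨z, hz⟩ : ℍ) : ℂ)
        = N * c * z + d :=
      (ModularGroup.denom_apply γ _).trans (by simp [γ])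
    have hd0 : (N * c * z + d : ℂ) ≠ 0 := hden ▸ denom_ne_zero _ (⟨z, hz⟩ : ℍ)
    have hsm : Matrix.SpecialLinearGroup.mapGL ℝ γ • (⟨z, hz⟩ : ℍ) =
        ofComplex ((a * z + b) / (N * c * z + d)) := by
      have : ((Matrix.SpecialLinearGroup.mapGL ℝ γ • (⟨z, hz⟩ : ℍ) : ℍ) : ℂ) =
          (a * z + b) / (N * c * z + d) := by
        refine (coe_specialLinearGroup_apply γ ⟨z, hz⟩).trans ?_
        simp [γ]
      rw [← this, ofComplex_apply]
    simp only [hsm, hden] at h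
    simp only [Function.comp_apply, ofComplex_apply_of_im_pos hz]
    have hk0 := pow_ne_zero k hd0
    have hγd : ((γ 1 1 : ℤ) : ZMod N) = d := by simp [γ]
    have hdet1 : ((Matrix.GeneralLinearGroup.det (Matrix.SpecialLinearGroup.mapGL ℝ γ) : ℝˣ) : ℝ)
        = 1 := by simp
    rw [hdet1, Real.one_rpow, ofReal_one, one_mul, inv_mul_eq_iff_eq_mul₀ hk0, hγd] at h
    rw [h]
    ring
  -- Such a point exists high in the half plane, because `f → 1` there.
  · obtain ⟨z, hz, hz0⟩ : ∃ z : ℂ, 0 < z.im ∧ (f ∘ ofComplex) z ≠ 0 := by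
      have hne : (comap Complex.im atTop).NeBot := by
        refine comap_neBot_iff_frequently.mpr (Eventually.frequently ?_)
        exact Eventually.of_forall fun y => ⟨y * Complex.I, by simp⟩
      have e1 : ∀ᶠ z in comap Complex.im atTop, (f ∘ ofComplex) z ≠ 0 :=
        hlim.eventually_ne one_ne_zero
      have e2 : ∀ᶠ z in comap Complex.im atTop, 0 < z.im :=
        preimage_mem_comap (Ioi_mem_atTop 0)
      obtain ⟨z, h1, h2⟩ := (e1.and e2).exists
      exact ⟨z, h2, h1⟩
    have hz' : z ≠ 0 := by rintro rfl; simp at hz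
    have e1 := hC z hz
    have e2 := hC (-1 / (N * z)) (im_neg_inv_pos (im_natMul_pos hN hz))
    have e3 : -1 / (N * (-1 / (N * z))) = z := by field_simp
    rw [e3, e1] at e2
    have e4 : 1 = C ^ 2 * ((-1 / (N * z)) ^ k * z ^ k) := by
      apply mul_right_cancel₀ hz0
      linear_combination e2
    rw [← mul_pow, show -1 / (N * z) * z = -1 / N by field_simp, div_pow] at e4
    have hNk := pow_ne_zero k hN'
    have h11 : ((-1 : ℂ) ^ k) ^ 2 = 1 := by rw [← pow_mul, mul_comm, pow_mul]; simp
    field_simp at e4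
    linear_combination -(-1) ^ k * e4 - C ^ 2 * h11

end

/-! ### The norm to level one -/

section

open UpperHalfPlane ModularForm EisensteinSeries Complex

open Filter Topology

/-- The norm `g(z) ∏_{j < N} g((z + j) / N)` from level `N` to level one, `N` prime. -/
noncomputable def frickeNorm (N : ℕ) (g : ℂ → ℂ) (z : ℂ) : ℂ :=
  g z * ∏ j ∈ Finset.range N, g ((z + j) / N)

lemma frickeNorm_eq_zero {N : ℕ} {g : ℂ → ℂ} {z : ℂ} (h : g z = 0) : frickeNorm N g z = 0 := by
  simp [frickeNorm, h]

/-- At `N z` the factor `j = 0` is `g(z)`. This second zero of the norm is what ties `j(z)` to `j(N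
z)`. -/
lemma frickeNorm_mul_eq_zero {N : ℕ} (hN : 0 < N) {g : ℂ → ℂ} {z : ℂ} (h : g z = 0) :
    frickeNorm N g (N * z) = 0 := by
  rw [frickeNorm, Finset.prod_eq_zero (i := 0) (by simpa using hN), mul_zero]
  have hN' : (N : ℂ) ≠ 0 := by exact_mod_cast hN.ne'
  rw [Nat.cast_zero, add_zero, mul_div_cancel_left₀ _ hN', h]

namespace FrickeForm

variable {N k : ℕ} {χ₀ : DirichletCharacter ℂ N} {C : ℂ} {g : ℂ → ℂ}

lemma add_one (hg : FrickeForm N k χ₀ C g) {z : ℂ} (hz : 0 < z.im) : g (z + 1) = g z := by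
  simpa using hg.gamma 1 1 0 1 (by ring) z hz

lemma norm_diff (hg : FrickeForm N k χ₀ C g) (hN : 0 < N) :
    DifferentiableOn ℂ (frickeNorm N g) {z | 0 < z.im} := by
  refine hg.diff.mul ?_
  refine DifferentiableOn.fun_finsetProd fun j _ => ?_
  refine hg.diff.comp (f := fun z : ℂ => (z + j) / N) (by fun_prop) ?_
  intro z hz
  exact im_add_div_pos hN hz j

/-- Translation permutes the factors cyclically; the last wraps around by `g(z+1) = g(z)`. -/
lemma norm_add_one (hg : FrickeForm N k χ₀ C g) (hN : 0 < N) {z : ℂ} (hz : 0 < z.im) :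
    frickeNorm N g (z + 1) = frickeNorm N g z := by
  obtain ⟨M, rfl⟩ : ∃ M, N = M + 1 := ⟨N - 1, by omega⟩
  have hN' : ((M + 1 : ℕ) : ℂ) ≠ 0 := by exact_mod_cast hN.ne'
  rw [frickeNorm, frickeNorm, hg.add_one hz, Finset.prod_range_succ, Finset.prod_range_succ']
  congr 2
  · refine Finset.prod_congr rfl fun j _ => ?_
    push_cast
    ring_nf
  · have : (z + 1 + (M : ℂ)) / ((M + 1 : ℕ) : ℂ) = (z + ((0 : ℕ) : ℂ)) / ((M + 1 : ℕ) : ℂ) + 1 := by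
      field_simp; push_cast; ring
    rw [this, hg.add_one (im_add_div_pos hN hz 0)]

lemma norm_tendsto (hg : FrickeForm N k χ₀ C g) (hN : 0 < N) :
    Tendsto (frickeNorm N g) (comap Complex.im atTop) (𝓝 1) := by
  have : Tendsto (frickeNorm N g) (comap Complex.im atTop)
      (𝓝 (1 * ∏ j ∈ Finset.range N, 1)) := by
    refine hg.tendsto.mul (tendsto_finsetProd _ fun j _ => ?_)
    refine hg.tendsto.comp (g := g) (f := fun z : ℂ => (z + j) / N) ?_
    rw [tendsto_comap_iff]
    have h1 : (Complex.im ∘ fun z : ℂ => (z + j) / N) = fun z : ℂ => z.im / N := by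
      ext z; simp [div_natCast_im]
    rw [h1]
    exact (tendsto_comap (f := Complex.im) (x := atTop)).atTop_div_const (by positivity)
  simpa using this

/-- With `j j' ≡ -1` modulo `N`, the matrix `(j, -m; N, -j')` of `Γ₀(N)` carries `(z+j')/N` to
`(-1/z+j)/N` with automorphy factor `z`. -/
lemma neg_inv_add_div (hg : FrickeForm N k χ₀ C g) (hN : 0 < N) {j j' : ℕ} {m : ℤ}
    (hj : (j : ℤ) * j' + 1 = N * m) {z : ℂ} (hz : 0 < z.im) :
    g ((-1 / z + j) / N) = χ₀ (-(j' : ZMod N)) * z ^ k * g ((z + j') / N) := by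
  have hN' : (N : ℂ) ≠ 0 := by exact_mod_cast hN.ne'
  have hz0 : z ≠ 0 := by rintro rfl; simp at hz
  have h := hg.gamma j (-m) 1 (-j') (by linear_combination -hj) ((z + j') / N)
    (im_add_div_pos hN hz j')
  have hjC : (j : ℂ) * j' + 1 = N * m := by exact_mod_cast hj
  have e1 : (N : ℂ) * ((1 : ℤ) : ℂ) * ((z + j') / N) + ((-j' : ℤ) : ℂ) = z := by
    push_cast; field_simp; ring
  have e2 : (((j : ℤ) : ℂ) * ((z + j') / N) + ((-m : ℤ) : ℂ)) / z = (-1 / z + j) / N := by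
    push_cast; field_simp; linear_combination hjC
  rw [e1, e2] at h
  rw [h]; push_cast; rfl

/-- The inversion exchanges `g(z)` and `g(z/N)` through the Fricke equation; the constants combine
to `C²/Nᵏ = (-1)ᵏ`, so the sign of `C` disappears. -/
lemma neg_inv_mul (hg : FrickeForm N k χ₀ C g) (hN : 0 < N) {z : ℂ} (hz : 0 < z.im) :
    g (-1 / z) * g (-1 / z / N) = (-1) ^ k * z ^ (2 * k) * (g z * g (z / N)) := by
  have hN' : (N : ℂ) ≠ 0 := by exact_mod_cast hN.ne'
  have hz0 : z ≠ 0 := by rintro rfl; simp at hz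
  have h1 := hg.fricke z hz
  have h2 := hg.fricke (z / N) (by simpa using im_add_div_pos hN hz 0)
  rw [mul_div_cancel₀ _ hN'] at h2
  have e : -1 / z / N = -1 / (N * z) := by field_simp
  rw [e, h1, h2, div_pow]
  have hk := pow_ne_zero k hN'
  field_simp
  linear_combination (z ^ k) ^ 2 * g (z / N) * g z * hg.sq_eq

/-- The norm is a level one form. -/
lemma exists_norm_form (hg : FrickeForm N k χ₀ C g) (hpar : χ₀ (-1) = (-1) ^ k)
    (hN : N = 2 ∨ N = 3 ∨ (N = 5 ∧ Even k)) :
    ∃ F : ModularForm 𝒮ℒ ((k * (N + 1) : ℕ) : ℤ), (∀ z : ℍ, F z = frickeNorm N g z) ∧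
      (qExpansion 1 F).coeff 0 = 1 := by
  have hN0 : 0 < N := by omega
  refine exists_levelOne_form (hg.norm_diff hN0) (fun z => hg.norm_add_one hN0) ?_
    (hg.norm_tendsto hN0)
  intro z hz
  have h0 := hg.neg_inv_mul hN0 hz
  have hsq : ((-1 : ℂ) ^ k) ^ 2 = 1 := by rw [← pow_mul, mul_comm, pow_mul]; simp
  -- The factors with `j ≠ 0` are permuted by `j ↦ j'`. Their character values multiply to `χ₀(-1)`,
  -- which cancels the `(-1)ᵏ` of the exchanged pair.
  rcases hN with rfl | rfl | ⟨rfl, hk⟩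
  · have h1 := hg.neg_inv_add_div hN0 (j := 1) (j' := 1) (m := 1) (by norm_num) hz
    simp only [frickeNorm, Finset.prod_range_succ, Finset.prod_range_zero, Nat.cast_zero, add_zero,
      one_mul]
    rw [← mul_assoc, h0, h1]
    push_cast
    rw [hpar]
    linear_combination z ^ (2 * k) * z ^ k * g z * g (z / 2) * g ((z + 1) / 2) * hsq
  · have h1 := hg.neg_inv_add_div hN0 (j := 1) (j' := 2) (m := 1) (by norm_num) hz
    have h2 := hg.neg_inv_add_div hN0 (j := 2) (j' := 1) (m := 1) (by norm_num) hz
    rw [show (-((2 : ℕ) : ZMod 3)) = 1 by decide, map_one] at h1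
    rw [Nat.cast_one, hpar] at h2
    simp only [frickeNorm, Finset.prod_range_succ, Finset.prod_range_zero, Nat.cast_zero, add_zero,
      one_mul]
    rw [← mul_assoc, ← mul_assoc, h0, h1, h2]
    push_cast
    linear_combination z ^ (2 * k) * z ^ k * z ^ k * g z * g (z / 3) * g ((z + 1) / 3)
      * g ((z + 2) / 3) * hsq
  · have h1 := hg.neg_inv_add_div hN0 (j := 1) (j' := 4) (m := 1) (by norm_num) hz
    have h2 := hg.neg_inv_add_div hN0 (j := 2) (j' := 2) (m := 1) (by norm_num) hz
    have h3 := hg.neg_inv_add_div hN0 (j := 3) (j' := 3) (m := 2) (by norm_num) hz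
    have h4 := hg.neg_inv_add_div hN0 (j := 4) (j' := 1) (m := 1) (by norm_num) hz
    rw [hk.neg_one_pow] at h0 hpar
    have hχ : χ₀ (-((2 : ℕ) : ZMod 5)) * χ₀ (-((3 : ℕ) : ZMod 5)) = 1 := by
      rw [← map_mul, show (-((2 : ℕ) : ZMod 5)) * -((3 : ℕ) : ZMod 5) = 1 by decide, map_one]
    rw [show (-((4 : ℕ) : ZMod 5)) = 1 by decide, map_one] at h1
    rw [Nat.cast_one, hpar] at h4
    simp only [frickeNorm, Finset.prod_range_succ, Finset.prod_range_zero, Nat.cast_zero, add_zero,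
      one_mul]
    rw [← mul_assoc, ← mul_assoc, ← mul_assoc, ← mul_assoc, h0, h1, h2, h3, h4]
    push_cast at hχ ⊢
    linear_combination z ^ (2 * k) * (z ^ k) ^ 4 * g z * g (z / 5) * g ((z + 1) / 5)
      * g ((z + 2) / 5) * g ((z + 3) / 5) * g ((z + 4) / 5) * hχ

end FrickeForm

/-- The point `n z`. -/
def natMul (n : ℕ) (hn : 0 < n) (z : ℍ) : ℍ := ⟨n * z, im_natMul_pos hn z.im_pos⟩

@[simp] lemma coe_natMul {n : ℕ} (hn : 0 < n) (z : ℍ) : (natMul n hn z : ℂ) = n * z := rfl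

end

/-! ### Points with prescribed isogenies -/

section

open UpperHalfPlane Complex

/-- If `z` and `N z` are equivalent, `z` is fixed by a matrix of determinant `N`. -/
lemma exists_matrix_of_jInv_natMul {N : ℕ} (hN : 0 < N) {z : ℍ}
    (h : jInv z = jInv (natMul N hN z)) :
    ∃ a b c d : ℤ, a * d - b * c = 1 ∧ (a : ℝ) - N * d = 2 * N * c * z.re ∧
      N * c * (z.re ^ 2 + z.im ^ 2) = -b ∧
      4 * N ^ 2 * c ^ 2 * z.im ^ 2 = 4 * N - ((a : ℝ) + N * d) ^ 2 := by
  obtain ⟨a, b, c, d, hdet, hw⟩ := exists_moebius_of_jInv_eq h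
  have hre := congrArg Complex.re hw
  have him := congrArg Complex.im hw
  simp at hre him
  have hy := z.im_ne_zero
  have e1 : (a : ℝ) - N * d = 2 * N * c * z.re := by
    apply mul_right_cancel₀ hy
    linear_combination -him
  have e2 : N * c * (z.re ^ 2 + z.im ^ 2) = -(b : ℝ) := by
    linear_combination -hre - z.re * e1
  have hdR : (a : ℝ) * d - b * c = 1 := by exact_mod_cast hdet
  refine ⟨a, b, c, d, hdet, e1, e2, ?_⟩
  linear_combination 4 * N * c * e2 + 4 * N * hdR + (a - N * d + 2 * N * c * z.re) * e1

lemma coeff_ne_zero_of_det {N : ℕ} (hN : 1 < N) {z : ℍ} {a b c d : ℤ} (hdet : a * d - b * c = 1)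
    (e1 : (a : ℝ) - N * d = 2 * N * c * z.re) : c ≠ 0 := by
  rintro rfl
  have : a = N * d := by
    have : (a : ℝ) = N * d := by simpa [sub_eq_zero] using e1
    exact_mod_cast this
  subst this
  have h1 : (N : ℤ) * (d * d) = 1 := by linear_combination hdet
  have := Int.eq_one_or_neg_one_of_mul_eq_one h1
  omega

/-- The bounds give `Im(z)² ≥ 1/4`, hence `c = ±1` and `|z|² = (1 - ad)/2`. Then `|z|² ≥ 1/2` gives
`ad ≤ 0`, and `(a - 2d)² ≤ 4` gives `ad > -1`. -/
lemma normSq_eq_of_jInv_two {z : ℍ} (h : jInv z = jInv (natMul 2 (by norm_num) z))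
    (h1 : 1 / 2 ≤ z.re ^ 2 + z.im ^ 2) (h2 : z.re ^ 2 ≤ 1 / 4) :
    z.re ^ 2 + z.im ^ 2 = 1 / 2 := by
  obtain ⟨a, b, c, d, hdet, e1, e2, e3⟩ := exists_matrix_of_jInv_natMul _ h
  have hc := coeff_ne_zero_of_det (by norm_num) hdet e1
  push_cast at e1 e2 e3
  have hdR : (a : ℝ) * d - b * c = 1 := by exact_mod_cast hdet
  have hc2 : c ^ 2 ≤ 2 := by
    have : (c : ℝ) ^ 2 ≤ 2 := by nlinarith [sq_nonneg ((a : ℝ) + 2 * d), sq_nonneg (c : ℝ)]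
    exact_mod_cast this
  have hc1 : c ^ 2 = 1 := by
    have : c ≤ 1 := by nlinarith
    have : -1 ≤ c := by nlinarith
    have : c = 1 ∨ c = -1 := by omega
    rcases this with rfl | rfl <;> norm_num
  have hcR : (c : ℝ) ^ 2 = 1 := by exact_mod_cast hc1
  have e4 : z.re ^ 2 + z.im ^ 2 = (1 - a * d) / 2 := by
    linear_combination (c / 2) * e2 + 1 / 2 * hdR - (z.re ^ 2 + z.im ^ 2) * hcR
  have hS : ((a : ℝ) - 2 * d) ^ 2 ≤ 4 := by
    rw [e1]; nlinarith
  have l1 : a * d ≤ 0 := by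
    have : (a : ℝ) * d ≤ 0 := by linarith
    exact_mod_cast this
  have l2 : 0 ≤ a * d := by
    have : (-1 : ℝ) < a * d := by nlinarith [sq_nonneg ((a : ℝ) + 2 * d)]
    have : (-1 : ℤ) < a * d := by exact_mod_cast this
    omega
  have l3 : (a : ℝ) * d = 0 := by exact_mod_cast le_antisymm l1 l2
  rw [e4, l3]; norm_num

lemma normSq_eq_of_jInv_three {z : ℍ} (h : jInv z = jInv (natMul 3 (by norm_num) z))
    (h1 : 1 / 3 ≤ z.re ^ 2 + z.im ^ 2) (h2 : z.re ^ 2 ≤ 1 / 4) :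
    z.re ^ 2 + z.im ^ 2 = 1 / 3 := by
  obtain ⟨a, b, c, d, hdet, e1, e2, e3⟩ := exists_matrix_of_jInv_natMul _ h
  have hc := coeff_ne_zero_of_det (by norm_num) hdet e1
  push_cast at e1 e2 e3
  have hdR : (a : ℝ) * d - b * c = 1 := by exact_mod_cast hdet
  have hc2 : c ^ 2 ≤ 4 := by
    have : (c : ℝ) ^ 2 ≤ 4 := by nlinarith [sq_nonneg ((a : ℝ) + 3 * d), sq_nonneg (c : ℝ)]
    exact_mod_cast this
  have hc1 : c ^ 2 = 1 ∨ c ^ 2 = 4 := by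
    have : c ≤ 2 := by nlinarith
    have : -2 ≤ c := by nlinarith
    have : c = 1 ∨ c = -1 ∨ c = 2 ∨ c = -2 := by omega
    rcases this with rfl | rfl | rfl | rfl <;> norm_num
  have hS : ((a : ℝ) - 3 * d) ^ 2 = 36 * c ^ 2 * z.re ^ 2 := by rw [e1]; ring
  have hT := sq_nonneg ((a : ℝ) + 3 * d)
  rcases hc1 with hc1 | hc1
  · have hcR : (c : ℝ) ^ 2 = 1 := by exact_mod_cast hc1
    have e4 : z.re ^ 2 + z.im ^ 2 = (1 - a * d) / 3 := by
      linear_combination (c / 3) * e2 + 1 / 3 * hdR - (z.re ^ 2 + z.im ^ 2) * hcR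
    rw [hcR] at hS
    have l1 : a * d ≤ 0 := by
      have : (a : ℝ) * d ≤ 0 := by linarith
      exact_mod_cast this
    have l2 : 0 ≤ a * d := by
      have : (-1 : ℝ) < a * d := by nlinarith
      have : (-1 : ℤ) < a * d := by exact_mod_cast this
      omega
    have l3 : (a : ℝ) * d = 0 := by exact_mod_cast le_antisymm l1 l2
    rw [e4, l3]; norm_num
  -- Here both bounds are attained: `ad = -3`, at the corner of the domain.
  · have hcR : (c : ℝ) ^ 2 = 4 := by exact_mod_cast hc1
    have e4 : z.re ^ 2 + z.im ^ 2 = (1 - a * d) / 12 := by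
      linear_combination (c / 12) * e2 + 1 / 12 * hdR - (z.re ^ 2 + z.im ^ 2) / 4 * hcR
    rw [hcR] at hS
    have l3 : (a : ℝ) * d = -3 := le_antisymm (by linarith) (by nlinarith)
    rw [e4, l3]; norm_num

lemma on_circles_of_jInv_five {z : ℍ} (h : jInv z = jInv (natMul 5 (by norm_num) z))
    (h1 : 1 / 5 ≤ z.re ^ 2 + z.im ^ 2) (h2 : z.re ^ 2 ≤ 1 / 4) (h3 : 1 / 25 ≤ z.im ^ 2) :
    z.re ^ 2 + z.im ^ 2 = 1 / 5 ∨ (z.re ^ 2 = 1 / 4 ∧ z.im ^ 2 = 1 / 20) := by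
  obtain ⟨a, b, c, d, hdet, e1, e2, e3⟩ := exists_matrix_of_jInv_natMul _ h
  have hc := coeff_ne_zero_of_det (by norm_num) hdet e1
  push_cast at e1 e2 e3
  have hdR : (a : ℝ) * d - b * c = 1 := by exact_mod_cast hdet
  have hc2 : c ^ 2 ≤ 5 := by
    have : (c : ℝ) ^ 2 ≤ 5 := by nlinarith [sq_nonneg ((a : ℝ) + 5 * d), sq_nonneg (c : ℝ)]
    exact_mod_cast this
  have hc1 : c ^ 2 = 1 ∨ c ^ 2 = 4 := by
    have : c ≤ 2 := by nlinarith
    have : -2 ≤ c := by nlinarith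
    have : c = 1 ∨ c = -1 ∨ c = 2 ∨ c = -2 := by omega
    rcases this with rfl | rfl | rfl | rfl <;> norm_num
  have hS : ((a : ℝ) - 5 * d) ^ 2 = 100 * c ^ 2 * z.re ^ 2 := by rw [e1]; ring
  have hT := sq_nonneg ((a : ℝ) + 5 * d)
  rcases hc1 with hc1 | hc1
  · left
    have hcR : (c : ℝ) ^ 2 = 1 := by exact_mod_cast hc1
    have e4 : z.re ^ 2 + z.im ^ 2 = (1 - a * d) / 5 := by
      linear_combination (c / 5) * e2 + 1 / 5 * hdR - (z.re ^ 2 + z.im ^ 2) * hcR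
    rw [hcR] at hS
    have l1 : a * d ≤ 0 := by
      have : (a : ℝ) * d ≤ 0 := by linarith
      exact_mod_cast this
    have l2 : -1 ≤ a * d := by
      have : (-2 : ℝ) < a * d := by nlinarith
      have : (-2 : ℤ) < a * d := by exact_mod_cast this
      omega
    have l3 : a * d ≠ -1 := by
      intro had
      have hS' : (a - 5 * d) ^ 2 ≤ 25 := by
        have : ((a : ℝ) - 5 * d) ^ 2 ≤ 25 := by rw [hS]; linarith
        exact_mod_cast this
      rcases Int.mul_eq_neg_one_iff_eq_one_or_neg_one.mp had with ⟨rfl, rfl⟩ | ⟨rfl, rfl⟩ <;>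
        norm_num at hS'
    have l4 : (a : ℝ) * d = 0 := by
      have : a * d = 0 := by omega
      exact_mod_cast this
    rw [e4, l4]; norm_num
  · have hcR : (c : ℝ) ^ 2 = 4 := by exact_mod_cast hc1
    have e4 : z.re ^ 2 + z.im ^ 2 = (1 - a * d) / 20 := by
      linear_combination (c / 20) * e2 + 1 / 20 * hdR - (z.re ^ 2 + z.im ^ 2) / 4 * hcR
    rw [hcR] at hS e3
    have hS' : (a - 5 * d) ^ 2 ≤ 100 := by
      have : ((a : ℝ) - 5 * d) ^ 2 ≤ 100 := by rw [hS]; linarith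
      exact_mod_cast this
    have hT' : (a + 5 * d) ^ 2 ≤ 4 := by
      have : ((a : ℝ) + 5 * d) ^ 2 ≤ 4 := by linarith
      exact_mod_cast this
    -- Parity: `ad = bc + 1` is odd, so `d = ±1` and `ad` is `-5` (the corner with real part `±1/2`)
    -- or `-3` (on `|z|² = 1/5`).
    have hev : Even c := by
      have : c = 2 ∨ c = -2 := by
        have : (c - 2) * (c + 2) = 0 := by linear_combination hc1
        rcases mul_eq_zero.mp this with h | h <;> omega
      rcases this with rfl | rfl <;> decide
    have hodd : Odd (a * d) := by
      rw [show a * d = b * c + 1 by linear_combination hdet]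
      exact (hev.mul_left b).add_one
    have b1 : -10 ≤ a - 5 * d := by nlinarith
    have b2 : a - 5 * d ≤ 10 := by nlinarith
    have b3 : -2 ≤ a + 5 * d := by nlinarith
    have b4 : a + 5 * d ≤ 2 := by nlinarith
    obtain ⟨hao, hdo⟩ := Int.odd_mul.mp hodd
    have hd1 : d = 1 ∨ d = -1 := by
      obtain ⟨m, hm⟩ := hdo
      omega
    have key : (a * d = -5 ∧ (a - 5 * d) ^ 2 = 100 ∧ (a + 5 * d) ^ 2 = 0) ∨ a * d = -3 := by
      obtain ⟨m, hm⟩ := hao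
      rcases hd1 with rfl | rfl
      · have : a = -5 ∨ a = -3 := by omega
        rcases this with rfl | rfl <;> norm_num
      · have : a = 5 ∨ a = 3 := by omega
        rcases this with rfl | rfl <;> norm_num
    rcases key with ⟨k1, k2, k3⟩ | k1
    · right
      have k2R : ((a : ℝ) - 5 * d) ^ 2 = 100 := by exact_mod_cast k2
      have k3R : ((a : ℝ) + 5 * d) ^ 2 = 0 := by exact_mod_cast k3
      constructor <;> linarith
    · left
      have k1R : (a : ℝ) * d = -3 := by exact_mod_cast k1
      rw [e4, k1R]; norm_num

/-! ### Fundamental domains and arcs in real coordinates -/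

lemma sq_norm_coe (z : ℍ) : ‖(z : ℂ)‖ ^ 2 = z.re ^ 2 + z.im ^ 2 := by
  rw [Complex.sq_norm, Complex.normSq_apply]; simp; ring

lemma one_div_sqrt_le_norm_iff {r : ℝ} (hr : 0 < r) (w : ℂ) :
    1 / √r ≤ ‖w‖ ↔ 1 / r ≤ ‖w‖ ^ 2 := by
  rw [← sq_le_sq₀ (by positivity) (norm_nonneg _), div_pow, Real.sq_sqrt hr.le, one_pow]

lemma norm_eq_one_div_sqrt_iff {r : ℝ} (hr : 0 < r) (w : ℂ) :
    ‖w‖ = 1 / √r ↔ ‖w‖ ^ 2 = 1 / r := by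
  rw [← sq_eq_sq₀ (norm_nonneg _) (by positivity), div_pow, Real.sq_sqrt hr.le, one_pow]

lemma two_mul_sqrt_five : 2 * √5 = √20 := by
  rw [show (20 : ℝ) = 2 ^ 2 * 5 by norm_num, Real.sqrt_mul (by norm_num),
    Real.sqrt_sq (by norm_num)]

lemma fundDomain_bounds {p : ℕ} (hp : 0 < p) {z : ℍ} (hz : z ∈ fundDomain p) :
    1 / (p : ℝ) ≤ z.re ^ 2 + z.im ^ 2 ∧ z.re ^ 2 ≤ 1 / 4 := by
  have hp' : (0 : ℝ) < p := by exact_mod_cast hp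
  rcases hz with ⟨h1, h2, h3⟩ | ⟨h1, h2, h3⟩
  · rw [one_div_sqrt_le_norm_iff hp', sq_norm_coe] at h1
    exact ⟨h1, by nlinarith⟩
  · have h1 := h1.le
    rw [one_div_sqrt_le_norm_iff hp', sq_norm_coe] at h1
    exact ⟨h1, by nlinarith⟩

lemma fundDomain_re_bounds {p : ℕ} {z : ℍ} (hz : z ∈ fundDomain p)
    (h : ‖(z : ℂ)‖ = 1 / √(p : ℝ)) : -(1 / 2) ≤ z.re ∧ z.re ≤ 0 := by
  rcases hz with ⟨h1, h2, h3⟩ | ⟨h1, h2, h3⟩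
  · exact ⟨h2, h3⟩
  · exact absurd h1 (by rw [h]; exact lt_irrefl _)

lemma mem_arc2 {z : ℍ} (hz : z ∈ fundDomain 2) (h : z.re ^ 2 + z.im ^ 2 = 1 / 2) :
    (z : ℂ) ∈ arc2 := by
  have hn : ‖(z : ℂ)‖ = 1 / √((2 : ℕ) : ℝ) := by
    rw [norm_eq_one_div_sqrt_iff (by norm_num), sq_norm_coe, h]; norm_num
  obtain ⟨h1, h2⟩ := fundDomain_re_bounds hz hn
  push_cast at hn
  refine ⟨hn, ?_, ?_⟩
  · rw [Complex.arg_of_im_nonneg_of_ne_zero z.im_pos.le z.ne_zero, ← Real.arccos_zero]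
    exact Real.arccos_le_arccos (div_nonpos_of_nonpos_of_nonneg h2 (norm_nonneg _))
  · have : 3 * Real.pi / 4 = Real.arccos (-(√2 / 2)) := by
      rw [Real.arccos_neg, ← Real.cos_pi_div_four, Real.arccos_cos (by positivity)
        (by linarith [Real.pi_pos])]
      ring
    rw [Complex.arg_of_im_nonneg_of_ne_zero z.im_pos.le z.ne_zero, this]
    apply Real.arccos_le_arccos
    rw [hn, div_div_eq_mul_div, div_one, coe_re]
    nlinarith [Real.sqrt_nonneg 2]

lemma mem_arc3 {z : ℍ} (hz : z ∈ fundDomain 3) (h : z.re ^ 2 + z.im ^ 2 = 1 / 3) :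
    (z : ℂ) ∈ arc3 := by
  have hn : ‖(z : ℂ)‖ = 1 / √((3 : ℕ) : ℝ) := by
    rw [norm_eq_one_div_sqrt_iff (by norm_num), sq_norm_coe, h]; norm_num
  obtain ⟨h1, h2⟩ := fundDomain_re_bounds hz hn
  push_cast at hn
  refine ⟨hn, ?_, ?_⟩
  · rw [Complex.arg_of_im_nonneg_of_ne_zero z.im_pos.le z.ne_zero, ← Real.arccos_zero]
    exact Real.arccos_le_arccos (div_nonpos_of_nonpos_of_nonneg h2 (norm_nonneg _))
  · have : 5 * Real.pi / 6 = Real.arccos (-(√3 / 2)) := by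
      rw [Real.arccos_neg, ← Real.cos_pi_div_six, Real.arccos_cos (by positivity)
        (by linarith [Real.pi_pos])]
      ring
    rw [Complex.arg_of_im_nonneg_of_ne_zero z.im_pos.le z.ne_zero, this]
    apply Real.arccos_le_arccos
    rw [hn, div_div_eq_mul_div, div_one, coe_re]
    nlinarith [Real.sqrt_nonneg 3]

lemma sq_norm_add_half (z : ℍ) : ‖(z : ℂ) + 1 / 2‖ ^ 2 = (z.re + 1 / 2) ^ 2 + z.im ^ 2 := by
  rw [Complex.sq_norm, Complex.normSq_apply]; simp; ring

lemma sq_norm_sub_half (z : ℍ) : ‖(z : ℂ) - 1 / 2‖ ^ 2 = (z.re - 1 / 2) ^ 2 + z.im ^ 2 := by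
  rw [Complex.sq_norm, Complex.normSq_apply]; simp; ring

/-- The value `1/25` is the squared height of `(±2 + i)/5`, where the two circles meet; on either
side of `|Re z| = 2/5` a different circle gives the bound. -/
lemma fundDomain5_bounds {z : ℍ} (hz : z ∈ fundDomain5) :
    1 / 5 ≤ z.re ^ 2 + z.im ^ 2 ∧ z.re ^ 2 ≤ 1 / 4 ∧ 1 / 25 ≤ z.im ^ 2 := by
  rcases hz with ⟨h1, h2, h3, h4⟩ | ⟨h1, h2, h3, h4⟩
  · rw [one_div_sqrt_le_norm_iff (by norm_num), sq_norm_coe] at h1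
    rw [two_mul_sqrt_five, one_div_sqrt_le_norm_iff (by norm_num), sq_norm_add_half] at h2
    refine ⟨h1, by nlinarith, ?_⟩
    rcases le_total z.re (-(2 / 5)) with h | h <;> nlinarith
  · have h1 := h1.le
    have h2 := h2.le
    rw [one_div_sqrt_le_norm_iff (by norm_num), sq_norm_coe] at h1
    rw [two_mul_sqrt_five, one_div_sqrt_le_norm_iff (by norm_num), sq_norm_sub_half] at h2
    refine ⟨h1, by nlinarith, ?_⟩
    rcases le_total z.re (2 / 5) with h | h <;> nlinarith

lemma mem_arc5 {z : ℍ} (hz : z ∈ fundDomain5) (h : z.re ^ 2 + z.im ^ 2 = 1 / 5 ∨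
    (z.re ^ 2 = 1 / 4 ∧ z.im ^ 2 = 1 / 20)) : z ∈ arc5 := by
  refine ⟨hz, ?_⟩
  rcases h with h | ⟨h, h'⟩
  · left
    rw [norm_eq_one_div_sqrt_iff (by norm_num), sq_norm_coe, h]
  · right
    have hx : z.re = -(1 / 2) := by
      have : (z.re - 1 / 2) * (z.re + 1 / 2) = 0 := by linear_combination h
      rcases mul_eq_zero.mp this with hx | hx
      · exfalso
        rcases hz with ⟨h1, h2, h3, h4⟩ | ⟨h1, h2, h3, h4⟩ <;> linarith
      · linarith
    rw [two_mul_sqrt_five, norm_eq_one_div_sqrt_iff (by norm_num), sq_norm_add_half, hx, h']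
    norm_num

lemma mem_arc5_of_jInv {z : ℍ} (hz : z ∈ fundDomain5)
    (h : jInv z = jInv (natMul 5 (by norm_num) z)) : z ∈ arc5 :=
  have hb := fundDomain5_bounds hz
  mem_arc5 hz (on_circles_of_jInv_five h hb.1 hb.2.1 hb.2.2)

end

/-! ### The Eisenstein space of weight four -/

section

open UpperHalfPlane ModularForm EisensteinSeries Complex

lemma hasSum_E₄ (z : ℍ) : HasSum (fun n : ℕ => if n = 0 then (1 : ℂ) else
    240 * (ArithmeticFunction.sigma 3 n : ℂ) * cexp (2 * Real.pi * Complex.I * z) ^ n) (E₄ z) := by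
  have h := EisensteinSeries.q_expansion_bernoulli (k := 4) (by norm_num) ⟨2, rfl⟩ z
  have hs := EisensteinSeries.summable_sigma_mul_cexp_pow (k := 4) (by norm_num) z
  simp only [Nat.reduceSub] at h hs
  have h4 : bernoulli 4 = -1 / 30 := by rw [bernoulli_eq_bernoulli'_of_ne_one (by norm_num)]; simp
  rw [h4] at h
  have hsum : Summable (fun n : ℕ => if n = 0 then (1 : ℂ) else
    240 * (ArithmeticFunction.sigma 3 n : ℂ) * cexp (2 * Real.pi * Complex.I * z) ^ n) := by
    refine (summable_nat_add_iff 1).mp ?_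
    simpa [mul_assoc] using ((summable_nat_add_iff 1).mpr hs).mul_left 240
  have h2 := hsum.hasSum
  rw [hsum.tsum_eq_zero_add] at h2
  convert! h2 using 1
  rw [h, tsum_pnat_eq_tsum_succ (f := fun n : ℕ => (ArithmeticFunction.sigma 3 n : ℂ) *
    cexp (2 * Real.pi * Complex.I * z) ^ (n : ℤ))]
  simp [mul_assoc, tsum_mul_left]
  norm_num
  norm_cast

lemma eisensteinSeries₂_four (χ₁ χ₂ : DirichletCharacter ℂ 1) (z : ℍ) :
    eisensteinSeries₂ 4 χ₁ χ₂ z = 1 / 240 * E₄ z := by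
  have hone : ∀ (χ : DirichletCharacter ℂ 1) (a : ZMod 1), χ a = 1 := by
    intro χ a
    rw [Subsingleton.elim a 1, map_one]
  have h := ((hasSum_E₄ z).mul_left (1 / 240)).tsum_eq
  rw [← h, eisensteinSeries₂]
  refine tsum_congr fun n => ?_
  rcases Nat.eq_zero_or_pos n with rfl | hn
  · simp [eisensteinCoeff, generalizedBernoulli, hone, Polynomial.bernoulli_eval_one]
    norm_num
  · simp only [eisensteinCoeff, hn.ne', if_false, hone, one_mul]
    rw [← Complex.exp_nat_mul, ArithmeticFunction.sigma_apply]
    push_cast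
    rw [show 2 * (Real.pi : ℂ) * Complex.I * n * z = n * (2 * Real.pi * Complex.I * z) by ring]
    ring

/-- The Eisenstein space of weight `4` and trivial character at prime level. -/
lemma mem_eisensteinSpace_four {N : ℕ} (hN : N.Prime) {f : ℍ → ℂ}
    (hf : f ∈ eisensteinSpace N 4 (1 : DirichletCharacter ℂ N)) :
    ∃ a b : ℂ, ∀ z, f z = a * E₄ z + b * E₄ (natMul N hN.pos z) := by
  have hNZ : NeZero N := ⟨hN.ne_zero⟩
  induction hf using Submodule.span_induction with
  | mem f hf =>
    obtain ⟨N₁, N₂, ℓ, h₁, h₂, χ₁, χ₂, hdvd, hmul, hprim, rfl⟩ := hf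
    have hprim : χ₁.IsPrimitive ∧ χ₂.IsPrimitive := by
      rcases hprim with ⟨h, h', _⟩ | ⟨h, _⟩
      · exact ⟨h, h'⟩
      · omega
    -- If one character has level 1, the other is trivial and primitive, so it has level 1 too.
    -- Level `N` for `χ₁` would force `N₂ = 1`, so only `E₄(z)` and `E₄(N z)` survive.
    have haux : ∀ {A B : ℕ} (hA : A ∣ N) (hB : B ∣ N) (ψ : DirichletCharacter ℂ A)
        (φ : DirichletCharacter ℂ B), A = 1 → φ.IsPrimitive →
        DirichletCharacter.changeLevel hA ψ * DirichletCharacter.changeLevel hB φ = 1 → B = 1 := by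
      intro A B hA hB ψ φ hA1 hφ hm
      subst hA1
      rw [DirichletCharacter.level_one ψ, map_one, one_mul,
        DirichletCharacter.changeLevel_eq_one_iff] at hm
      subst hm
      have : NeZero B := ⟨fun h => hN.ne_zero (by simpa [h] using hB)⟩
      rw [DirichletCharacter.IsPrimitive, DirichletCharacter.conductor_one] at hφ
      exact hφ.symm
    have h11 : N₁ = 1 ∧ N₂ = 1 := by
      rcases (Nat.dvd_prime hN).mp h₁ with h | h
      · exact ⟨h, haux h₁ h₂ χ₁ χ₂ h hprim.2 hmul⟩
      · have hN2 : N₂ = 1 := by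
          have : N * (ℓ * N₂) ∣ N * 1 := by
            rw [h] at hdvd; convert! hdvd using 1 <;> ring
          exact Nat.eq_one_of_mul_eq_one_left (Nat.dvd_one.mp (Nat.dvd_of_mul_dvd_mul_left hN.pos this))
        exact ⟨haux h₂ h₁ χ₂ χ₁ hN2 hprim.1 (by rw [mul_comm]; exact hmul), hN2⟩
    obtain ⟨rfl, rfl⟩ := h11
    rw [mul_one, mul_one] at hdvd
    rcases (Nat.dvd_prime hN).mp hdvd with rfl | rfl
    · refine ⟨1 / 240, 0, fun z => ?_⟩
      simp only [Nat.cast_one, one_mul, zero_mul, add_zero]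
      exact eisensteinSeries₂_four χ₁ χ₂ z
    · refine ⟨0, 1 / 240, fun z => ?_⟩
      rw [zero_mul, zero_add]
      exact eisensteinSeries₂_four χ₁ χ₂ (natMul ℓ hN.pos z)
  | zero => exact ⟨0, 0, fun z => by simp⟩
  | add f g _ _ hf hg =>
    obtain ⟨a, b, h⟩ := hf
    obtain ⟨a', b', h'⟩ := hg
    exact ⟨a + a', b + b', fun z => by rw [Pi.add_apply, h, h']; ring⟩
  | smul c f _ hf =>
    obtain ⟨a, b, h⟩ := hf
    exact ⟨c * a, c * b, fun z => by rw [Pi.smul_apply, h, smul_eq_mul]; ring⟩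

/-- At this height `|q| ≤ 2⁻¹³`, and the crude bound `σ₃(n) ≤ n⁴ ≤ 16ⁿ` compares the tail with a
geometric series of sum at most `240/511`. -/
lemma norm_E₄_sub_one_lt {z : ℍ} (hz : 3 / 2 ≤ z.im) : ‖E₄ z - 1‖ < 1 / 2 := by
  set q := cexp (2 * Real.pi * Complex.I * z) with hq
  set r : ℝ := Real.exp (-(2 * Real.pi * z.im)) with hr
  have hqr : ‖q‖ = r := by
    rw [hq, Complex.norm_exp, hr]; simp
  have hr0 : 0 < r := Real.exp_pos _
  have hr1 : r ≤ 1 / 8192 := by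
    have h13 : (8192 : ℝ) = Real.exp (13 * Real.log 2) := by
      rw [show 13 * Real.log 2 = Real.log (2 ^ 13) by rw [Real.log_pow]; norm_num,
        Real.exp_log (by norm_num)]
      norm_num
    rw [h13, one_div, ← Real.exp_neg]
    apply Real.exp_le_exp.mpr
    have : Real.pi * (3 / 2) ≤ Real.pi * z.im := mul_le_mul_of_nonneg_left hz Real.pi_pos.le
    linarith [Real.pi_gt_d2, Real.log_two_lt_d9]
  have h1 := (hasSum_nat_add_iff' 1).mpr (hasSum_E₄ z)
  simp only [Finset.range_one, Finset.sum_singleton, if_true] at h1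
  have h2 := ((hasSum_geometric_of_lt_one (r := 16 * r) (by positivity) (by linarith)).mul_left
    (240 * (16 * r)))
  have h3 := h1.norm_le_of_bounded h2 fun n => ?_
  · refine h3.trans_lt ?_
    rw [← div_eq_mul_inv, div_lt_iff₀ (by linarith)]
    linarith
  · rw [if_neg n.succ_ne_zero, norm_mul, norm_mul, norm_pow, hqr, Complex.norm_natCast]
    have hσ : (ArithmeticFunction.sigma 3 (n + 1) : ℝ) ≤ 16 ^ (n + 1) := by
      have h5 : ArithmeticFunction.sigma 3 (n + 1) ≤ 16 ^ (n + 1) :=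
        (ArithmeticFunction.sigma_le_pow_succ 3 (n + 1)).trans <| by
          calc (n + 1) ^ (3 + 1) ≤ (2 ^ (n + 1)) ^ 4 := Nat.pow_le_pow_left Nat.lt_two_pow_self.le _
            _ = 16 ^ (n + 1) := by rw [← pow_mul, mul_comm, pow_mul]; norm_num
      exact_mod_cast h5
    calc ‖(240 : ℂ)‖ * (ArithmeticFunction.sigma 3 (n + 1) : ℝ) * r ^ (n + 1)
        ≤ 240 * 16 ^ (n + 1) * r ^ (n + 1) := by gcongr; norm_num
      _ = 240 * (16 * r) * (16 * r) ^ n := by ring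

/-- The involution `z ↦ -z̄` of the upper half plane. -/
noncomputable def negConj (z : ℍ) : ℍ := ⟨-(starRingEnd ℂ) z, by simpa using z.im_pos⟩

@[simp] lemma coe_negConj (z : ℍ) : (negConj z : ℂ) = -(starRingEnd ℂ) z := rfl

lemma E₄_negConj (z : ℍ) : E₄ (negConj z) = (starRingEnd ℂ) (E₄ z) := by
  refine (hasSum_E₄ (negConj z)).unique ?_
  refine (Complex.hasSum_conj'.mpr (hasSum_E₄ z)).congr_fun fun n => ?_
  split_ifs
  · simp
  · rw [map_mul, map_mul, map_pow, ← Complex.exp_conj, map_natCast, map_ofNat]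
    simp [map_ofNat (starRingEnd ℂ) 2]

/-- Conjugation by `diag(-1, 1)` preserves `SL₂(ℤ)`. -/
lemma jInv_negConj_congr {z w : ℍ} (h : jInv z = jInv w) :
    jInv (negConj z) = jInv (negConj w) := by
  obtain ⟨a, b, c, d, hdet, hw⟩ := exists_moebius_of_jInv_eq h
  refine (jInv_moebius (a := a) (b := -b) (c := -c) (d := d) (by linear_combination hdet) ?_).symm
  have h2 := congrArg (starRingEnd ℂ) hw
  simp only [map_mul, map_add, map_intCast] at h2
  simp only [coe_negConj]
  push_cast
  linear_combination -h2

end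

/-! ### Weight four with trivial character -/

section

open UpperHalfPlane ModularForm EisensteinSeries Complex

open Filter Topology

@[simp] lemma natMul_im {n : ℕ} (hn : 0 < n) (z : ℍ) : (natMul n hn z).im = n * z.im := by
  rw [← coe_im, coe_natMul]; simp

@[simp] lemma natMul_re {n : ℕ} (hn : 0 < n) (z : ℍ) : (natMul n hn z).re = n * z.re := by
  rw [← coe_re, coe_natMul]; simp

lemma E₄_moebius {a b c d : ℤ} (h : a * d - b * c = 1) {z w : ℍ}
    (hw : (w : ℂ) * (c * z + d) = a * z + b) : E₄ w = (c * z + d) ^ 4 * E₄ z := by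
  exact_mod_cast levelOne_moebius E₄ h hw

lemma norm_eq_of_sq_eq {N : ℕ} {C : ℂ} (h : C ^ 2 = N ^ 4) : ‖C‖ = N ^ 2 := by
  have h2 : ‖C‖ ^ 2 = ((N : ℝ) ^ 2) ^ 2 := by
    rw [← norm_pow, h, norm_pow, Complex.norm_natCast]; ring
  exact (sq_eq_sq₀ (norm_nonneg _) (by positivity)).mp h2

/-- At prime level, weight `4` and trivial character, an Eisenstein form with a Fricke
functional equation is proportional to `E₄(z) + C E₄(N z)`. -/
lemma FrickeForm.eq_E₄_add {N : ℕ} (hN : N.Prime) {C : ℂ} {f : ℍ → ℂ}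
    (hg : FrickeForm N 4 1 C (f ∘ ofComplex))
    (hf : f ∈ eisensteinSpace N 4 (1 : DirichletCharacter ℂ N))
    (h1 : Tendsto f atImInfty (𝓝 1)) :
    ∃ a ≠ 0, ∀ z, f z = a * (E₄ z + C * E₄ (natMul N hN.pos z)) := by
  obtain ⟨a, b, hab⟩ := mem_eisensteinSpace_four hN hf
  have hC : C ^ 2 = N ^ 4 := by rw [hg.sq_eq]; norm_num
  have hN0 : (N : ℂ) ≠ 0 := by exact_mod_cast hN.ne_zero
  -- The Fricke involution exchanges `E₄(z)` and `E₄(N z)` up to factors; compare both sides of the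
  -- functional equation using `N⁴ = C²`.
  have key : ∀ z : ℍ, (C * a - b) * (C * E₄ (natMul N hN.pos z) - E₄ z) = 0 := by
    intro z
    let w : ℍ := ⟨-1 / (N * z), im_neg_inv_pos (im_natMul_pos hN.pos z.im_pos)⟩
    have hz := z.ne_zero
    have hw : (w : ℂ) = -1 / (N * z) := rfl
    have e1 : E₄ w = (N * z) ^ 4 * E₄ (natMul N hN.pos z) := by
      have := E₄_moebius (a := 0) (b := -1) (c := 1) (d := 0) (by norm_num)
        (z := natMul N hN.pos z) (w := w) (by rw [hw, coe_natMul]; push_cast; field_simp; ring)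
      rw [this]; simp
    have e2 : E₄ (natMul N hN.pos w) = z ^ 4 * E₄ z := by
      have := E₄_moebius (a := 0) (b := -1) (c := 1) (d := 0) (by norm_num)
        (z := z) (w := natMul N hN.pos w) (by rw [coe_natMul, hw]; push_cast; field_simp; ring)
      rw [this]; simp
    have e3 := hg.fricke z z.im_pos
    rw [← hw, Function.comp_apply, Function.comp_apply, ofComplex_apply, ofComplex_apply, hab,
      hab, e1, e2] at e3
    apply mul_left_cancel₀ (pow_ne_zero 4 hz)
    linear_combination e3 + z ^ 4 * a * E₄ (natMul N hN.pos z) * hC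
  -- At `2i` both values of `E₄` are within `1/2` of `1`, while `|C| = N² ≥ 4`.
  have hne : C * E₄ (natMul N hN.pos ⟨2 * Complex.I, by simp⟩) - E₄ ⟨2 * Complex.I, by simp⟩ ≠ 0 := by
    intro h0
    set z : ℍ := ⟨2 * Complex.I, by simp⟩
    have hzi : z.im = 2 := by rw [← coe_im]; simp [z]
    have hN2 : (2 : ℝ) ≤ N := by exact_mod_cast hN.two_le
    have b1 := norm_E₄_sub_one_lt (z := z) (by rw [hzi]; norm_num)
    have b2 := norm_E₄_sub_one_lt (z := natMul N hN.pos z) (by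
      rw [natMul_im, hzi]; linarith)
    have b3 : ‖E₄ z‖ < 3 / 2 := by
      have := norm_add_le (E₄ z - 1) 1
      rw [sub_add_cancel, norm_one] at this
      linarith
    have b4 : 1 / 2 < ‖E₄ (natMul N hN.pos z)‖ := by
      have := norm_sub_norm_le 1 (E₄ (natMul N hN.pos z))
      rw [norm_one, norm_sub_rev] at this
      linarith
    rw [sub_eq_zero] at h0
    have h5 := congrArg norm h0
    rw [norm_mul, norm_eq_of_sq_eq hC] at h5
    nlinarith
  have hb : C * a - b = 0 := (mul_eq_zero.mp (key _)).resolve_right hne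
  refine ⟨a, ?_, fun z => by rw [hab]; linear_combination -E₄ (natMul N hN.pos z) * hb⟩
  rintro rfl
  have : f = fun _ => 0 := by
    ext z
    rw [hab]; linear_combination -E₄ (natMul N hN.pos z) * hb
  rw [this] at h1
  exact zero_ne_one (tendsto_nhds_unique tendsto_const_nhds h1)

/-! ### Quadratic points -/

/-- `z` is a root of an integral binary quadratic form of discriminant `D`. -/
def IsCM (D : ℤ) (z : ℍ) : Prop :=
  ∃ α β δ : ℤ, α ≠ 0 ∧ (α : ℂ) * z ^ 2 + β * z + δ = 0 ∧ β ^ 2 - 4 * α * δ = D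

/-- A unimodular substitution in the quadratic form preserves its discriminant. The leading
coefficient stays nonzero, since otherwise `Im w > 0` would force `D = 0`. -/
lemma IsCM.of_jInv_eq {D : ℤ} (hD : D ≠ 0) {z w : ℍ} (hz : IsCM D z) (h : jInv z = jInv w) :
    IsCM D w := by
  obtain ⟨α, β, δ, hα, hq, hdisc⟩ := hz
  obtain ⟨a, b, c, d, hdet, hw⟩ := exists_moebius_of_jInv_eq h
  have hdC : (a : ℂ) * d - b * c = 1 := by exact_mod_cast hdet
  have hinv : (z : ℂ) * (a - c * w) = d * w - b := by linear_combination -hw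
  have hq' : (((α * d ^ 2 - β * c * d + δ * c ^ 2 : ℤ)) : ℂ) * w ^ 2 +
      ((-2 * α * b * d + β * (a * d + b * c) - 2 * δ * a * c : ℤ) : ℂ) * w +
      ((α * b ^ 2 - β * a * b + δ * a ^ 2 : ℤ) : ℂ) = 0 := by
    push_cast
    linear_combination (a - c * w : ℂ) ^ 2 * hq - (α * (z * (a - c * w) + (d * w - b)) +
      β * (a - c * w)) * hinv
  have hdisc' : (-2 * α * b * d + β * (a * d + b * c) - 2 * δ * a * c) ^ 2 -
      4 * (α * d ^ 2 - β * c * d + δ * c ^ 2) * (α * b ^ 2 - β * a * b + δ * a ^ 2) = D := by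
    linear_combination hdisc + (β ^ 2 - 4 * α * δ) * (a * d - b * c + 1) * hdet
  refine ⟨_, _, _, ?_, hq', hdisc'⟩
  intro h0
  rw [h0] at hq' hdisc'
  set β' : ℤ := -2 * α * b * d + β * (a * d + b * c) - 2 * δ * a * c
  have him := congrArg Complex.im hq'
  simp [-mul_eq_zero, -Int.cast_mul, -Int.cast_sub, -Int.cast_add, -Int.cast_pow] at him
  have : β' = 0 := by
    have := (mul_eq_zero.mp him).resolve_right w.im_ne_zero
    exact_mod_cast this
  rw [this] at hdisc'
  exact hD (by linear_combination -hdisc')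

lemma IsCM.exists_coords {D : ℤ} {z : ℍ} (hz : IsCM D z) :
    ∃ α β δ : ℤ, α ≠ 0 ∧ β ^ 2 - 4 * α * δ = D ∧ 2 * (α : ℝ) * z.re = -β ∧
      4 * (α : ℝ) ^ 2 * z.im ^ 2 = -D := by
  obtain ⟨α, β, δ, hα, hq, hdisc⟩ := hz
  have hre := congrArg Complex.re hq
  have him := congrArg Complex.im hq
  simp [pow_two] at hre him
  have e1 : 2 * (α : ℝ) * z.re = -β := by
    apply mul_right_cancel₀ z.im_ne_zero
    linear_combination him
  have hdR : (β : ℝ) ^ 2 - 4 * α * δ = D := by exact_mod_cast hdisc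
  refine ⟨α, β, δ, hα, hdisc, e1, ?_⟩
  linear_combination -4 * α * hre - hdR + (2 * α * z.re + β) * e1

/-- Discriminant `-4` gives a rational imaginary part, discriminant `-20` a rational multiple of
`√5`. -/
lemma IsCM.not_of_im {z w : ℍ} {r : ℚ} (h : w.im = r * z.im) (hz : IsCM (-4) z)
    (hw : IsCM (-20) w) : False := by
  obtain ⟨α, β, δ, hα, -, -, h1⟩ := hz.exists_coords
  obtain ⟨α', β', δ', hα', -, -, h2⟩ := hw.exists_coords
  push_cast at h1 h2
  have hirr : Irrational (√5) := by
    have := Nat.Prime.irrational_sqrt (p := 5) (by norm_num)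
    exact_mod_cast this
  have hαR : (α : ℝ) ≠ 0 := by exact_mod_cast hα
  have h5 : √5 = |(α' : ℝ) * r / α| := by
    rw [← Real.sqrt_sq_eq_abs]
    congr 1
    rw [h] at h2
    field_simp
    apply mul_right_cancel₀ (pow_ne_zero 2 z.im_ne_zero)
    linarith
  rw [h5] at hirr
  exact hirr ⟨|(α' : ℚ) * r / α|, by push_cast; rfl⟩

end

/-! ### Points on the arcs at level five -/

section

open UpperHalfPlane ModularForm EisensteinSeries Complex

open Filter Topology

/-- A point of the fundamental domain at which `5 z` and `-z̄` are equivalent lies on the arcs. -/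
lemma mem_arc5_of_jInv_negConj {z : ℍ} (hz : z ∈ fundDomain5)
    (h : jInv (negConj z) = jInv (natMul 5 (by norm_num) z)) : z ∈ arc5 := by
  obtain ⟨h1, h2, h3⟩ := fundDomain5_bounds hz
  obtain ⟨a, b, c, d, hdet, hw⟩ := exists_moebius_of_jInv_eq h
  have hre := congrArg Complex.re hw
  have him := congrArg Complex.im hw
  simp at hre him
  have had : a = 5 * d := by
    have : (a : ℝ) = 5 * d := by
      apply mul_right_cancel₀ z.im_ne_zero
      linear_combination -him
    exact_mod_cast this
  subst had
  push_cast at hre him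
  have hdR : (5 : ℝ) * d * d - b * c = 1 := by exact_mod_cast hdet
  -- That is, `|c z - d|² = 1/5`; together with `Im(z)² ≥ 1/25` this bounds `c`. For `c = ±1` the
  -- strip `|Re z| ≤ 1/2` yields `|z|² ≤ 1/5`; for `c = ±2`, `d ≠ 0` gives the circle about `1/2` or
  -- `-1/2`.
  have e1 : (d : ℝ) ^ 2 - 2 * c * d * z.re + c ^ 2 * (z.re ^ 2 + z.im ^ 2) = 1 / 5 := by
    linear_combination 1 / 5 * hdR - c / 5 * hre
  have hc0 : c ≠ 0 := by
    rintro rfl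
    have := Int.eq_one_or_neg_one_of_mul_eq_one (u := 5) (v := d * d) (by linear_combination hdet)
    omega
  have hx1 : -(1 / 2) ≤ z.re := by nlinarith
  have hx2 : z.re ≤ 1 / 2 := by nlinarith
  have hc2 : c ^ 2 ≤ 5 := by
    have : (c : ℝ) ^ 2 ≤ 5 := by nlinarith [sq_nonneg ((c : ℝ) * z.re - d), sq_nonneg (c : ℝ)]
    exact_mod_cast this
  have hc1 : c = 1 ∨ c = -1 ∨ c = 2 ∨ c = -2 := by
    have : c ≤ 2 := by nlinarith
    have : -2 ≤ c := by nlinarith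
    omega
  have hdd : (d : ℝ) ≤ d ^ 2 ∧ -(d : ℝ) ≤ d ^ 2 := by
    have i1 : d ≤ d ^ 2 := Int.le_self_sq d
    have i2 : -d ≤ d ^ 2 := by rw [← neg_sq]; exact Int.le_self_sq (-d)
    exact ⟨by exact_mod_cast i1, by exact_mod_cast i2⟩
  have hone : c ^ 2 = 1 → z ∈ arc5 := by
    intro hcc
    have hcR : (c : ℝ) ^ 2 = 1 := by exact_mod_cast hcc
    refine mem_arc5 hz (Or.inl (le_antisymm ?_ h1))
    rw [hcR] at e1
    have : 2 * (c : ℝ) * d * z.re ≤ d ^ 2 := by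
      have hq : (2 * (c : ℝ) * d * z.re) ^ 2 ≤ (d ^ 2 : ℝ) ^ 2 := by
        have hd4 : (d : ℝ) ^ 2 ≤ (d ^ 2 : ℝ) ^ 2 := by
          have := Int.le_self_sq (d ^ 2)
          exact_mod_cast this
        have : (2 * (c : ℝ) * d * z.re) ^ 2 = (d : ℝ) ^ 2 * (4 * z.re ^ 2) := by
          linear_combination 4 * (d : ℝ) ^ 2 * z.re ^ 2 * hcR
        rw [this]
        nlinarith [sq_nonneg (d : ℝ)]
      exact (abs_le_of_sq_le_sq' hq (sq_nonneg _)).2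
    linarith
  have htwo : ∀ e : ℤ, (e : ℝ) ^ 2 - 4 * e * z.re + 4 * (z.re ^ 2 + z.im ^ 2) = 1 / 5 →
      e ≠ 0 → z ∈ arc5 := by
    intro e he he0
    have q1 : (2 * z.re - e) ^ 2 ≤ 1 / 25 := by nlinarith
    have q2 : (e : ℝ) < 2 := by nlinarith
    have q3 : (-2 : ℝ) < e := by nlinarith
    have q2' : e < 2 := by exact_mod_cast q2
    have q3' : -2 < e := by exact_mod_cast q3
    have : e = 1 ∨ e = -1 := by omega
    rcases this with rfl | rfl
    · exfalso
      push_cast at he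
      rcases hz with ⟨g1, g2, g3, g4⟩ | ⟨g1, g2, g3, g4⟩
      · nlinarith
      · have : ‖(z : ℂ) - 1 / 2‖ = 1 / (2 * √5) := by
          rw [two_mul_sqrt_five, norm_eq_one_div_sqrt_iff (by norm_num), sq_norm_sub_half]
          linarith
        linarith
    · refine ⟨hz, Or.inr ?_⟩
      push_cast at he
      rw [two_mul_sqrt_five, norm_eq_one_div_sqrt_iff (by norm_num), sq_norm_add_half]
      linarith
  have hodd : c = 2 ∨ c = -2 → d ≠ 0 := by
    rintro (rfl | rfl) rfl <;> omega
  rcases hc1 with rfl | rfl | rfl | rfl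
  · exact hone (by norm_num)
  · exact hone (by norm_num)
  · refine htwo d (by push_cast at e1; linarith) (hodd (by norm_num))
  · refine htwo (-d) (by push_cast at e1 ⊢; linarith) (neg_ne_zero.mpr (hodd (by norm_num)))

/-- Points of discriminant `-20` in the fundamental domain. -/
lemma mem_arc5_of_isCM {z : ℍ} (hz : z ∈ fundDomain5) (h : IsCM (-20) z)
    (h' : IsCM (-20) (natMul 5 (by norm_num) z)) : z ∈ arc5 := by
  obtain ⟨h1, h2, h3⟩ := fundDomain5_bounds hz
  obtain ⟨α, β, δ, hα, hd, e1, e2⟩ := h.exists_coords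
  obtain ⟨α', β', δ', hα', hd', e1', e2'⟩ := h'.exists_coords
  rw [natMul_im] at e2'
  push_cast at e2 e2'
  have hy : 0 < z.im ^ 2 := by have := z.im_pos; positivity
  have hαα : α ^ 2 = 25 * α' ^ 2 := by
    have : (α : ℝ) ^ 2 = 25 * α' ^ 2 := by
      apply mul_right_cancel₀ hy.ne'
      linarith
    exact_mod_cast this
  have hα'2 : α' ^ 2 ≤ 5 := by
    have : (α' : ℝ) ^ 2 ≤ 5 := by nlinarith [sq_nonneg (α' : ℝ)]
    exact_mod_cast this
  have hα'1 : α' ^ 2 = 1 ∨ α' ^ 2 = 4 := by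
    have : α' ≤ 2 := by nlinarith
    have : -2 ≤ α' := by nlinarith
    have : α' = 1 ∨ α' = -1 ∨ α' = 2 ∨ α' = -2 := by omega
    rcases this with rfl | rfl | rfl | rfl <;> norm_num
  have hs : 4 * (α : ℝ) ^ 2 * z.re ^ 2 = β ^ 2 := by
    linear_combination (2 * α * z.re - β) * e1
  have hαR : (α : ℝ) ^ 2 = 25 * α' ^ 2 := by exact_mod_cast hαα
  have hβ2 : β ^ 2 ≤ α ^ 2 := by
    have : (β : ℝ) ^ 2 ≤ α ^ 2 := by nlinarith [sq_nonneg (α : ℝ)]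
    exact_mod_cast this
  -- As `5 ∣ α`, the discriminant relation reads `β² = 20(tδ - 1)`. With `β² ≤ α²` and `α = ±5` or
  -- `±10`, this leaves only `β = 0` or `β = ±10`.
  obtain ⟨m, hm⟩ : (10 : ℤ) ∣ β := by
    have hp5 : Prime (5 : ℤ) := Int.prime_iff_natAbs_prime.mpr (by norm_num)
    have h5 : (5 : ℤ) ∣ α := hp5.dvd_of_dvd_pow (n := 2) ⟨5 * α' ^ 2, by rw [hαα]; ring⟩
    obtain ⟨t, rfl⟩ := h5
    have h20 : β ^ 2 = 20 * (t * δ - 1) := by linear_combination hd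
    have b5 : (5 : ℤ) ∣ β := hp5.dvd_of_dvd_pow (n := 2) ⟨4 * (t * δ - 1), by rw [h20]; ring⟩
    have b2 : (2 : ℤ) ∣ β := Int.prime_two.dvd_of_dvd_pow (n := 2) ⟨10 * (t * δ - 1), by rw [h20]; ring⟩
    omega
  subst hm
  refine mem_arc5 hz ?_
  rcases hα'1 with hc | hc
  · left
    have hcR : (α' : ℝ) ^ 2 = 1 := by exact_mod_cast hc
    have hm : m = 0 := by
      have : m ^ 2 < 1 := by nlinarith
      nlinarith
    subst hm
    rw [hαR, hcR] at hs e2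
    push_cast at hs
    linarith
  · right
    have hcR : (α' : ℝ) ^ 2 = 4 := by exact_mod_cast hc
    have hm : m ^ 2 = 1 := by
      have u1 : m ≤ 1 := by nlinarith
      have u2 : -1 ≤ m := by nlinarith
      have u3 : m ≠ 0 := by
        rintro rfl
        have h10 : α = 10 ∨ α = -10 := by
          have : (α - 10) * (α + 10) = 0 := by linear_combination hαα + 25 * hc
          rcases mul_eq_zero.mp this with h | h <;> omega
        rcases h10 with rfl | rfl <;> omega
      have : m = 1 ∨ m = -1 := by omega
      rcases this with rfl | rfl <;> norm_num
    have hmR : (m : ℝ) ^ 2 = 1 := by exact_mod_cast hm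
    rw [hαR, hcR] at hs e2
    push_cast at hs
    constructor <;> linarith

end

/-! ### A zero on the circle `|z| = 1 / √5` -/

section

open UpperHalfPlane ModularForm EisensteinSeries Complex

open Filter Topology

/-- Here `q` is real and positive, and so are all Fourier coefficients. -/
lemma E₄_of_re_int {z : ℍ} {n : ℤ} (h : z.re = n) : (E₄ z).im = 0 ∧ 0 < (E₄ z).re := by
  set r : ℝ := Real.exp (-(2 * Real.pi * z.im)) with hr
  have hq : cexp (2 * Real.pi * Complex.I * z) = r := by
    have : 2 * Real.pi * Complex.I * z = ((-(2 * Real.pi * z.im) : ℝ) : ℂ) +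
        n * (2 * Real.pi * Complex.I) := by
      rw [← re_add_im (z : ℂ), coe_re, coe_im, h]
      push_cast
      linear_combination 2 * Real.pi * z.im * I_sq
    rw [this, Complex.exp_add, Complex.exp_int_mul_two_pi_mul_I, mul_one, ← Complex.ofReal_exp]
  have hs := hasSum_E₄ z
  rw [hq] at hs
  have hterm : ∀ m : ℕ, (if m = 0 then (1 : ℂ) else
      240 * (ArithmeticFunction.sigma 3 m : ℂ) * (r : ℂ) ^ m) = ((if m = 0 then (1 : ℝ) else
      240 * (ArithmeticFunction.sigma 3 m : ℝ) * r ^ m : ℝ) : ℂ) := by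
    intro m
    split_ifs <;> push_cast <;> rfl
  simp only [hterm] at hs
  have him := Complex.hasSum_im hs
  have hre := Complex.hasSum_re hs
  simp only [Complex.ofReal_im, Complex.ofReal_re] at him hre
  refine ⟨him.unique hasSum_zero, lt_of_lt_of_le one_pos ?_⟩
  have := le_hasSum hre 0 fun m _ => by
    have := Real.exp_pos (-(2 * Real.pi * z.im))
    split_ifs <;> positivity
  simpa using this

/-- `-z̄ = z - n` makes the value real; closeness to `1` makes it positive, which sign-alternating
terms alone would not. -/
lemma E₄_of_re_half_odd {z : ℍ} {n : ℤ} (h : 2 * z.re = n) (him : 3 / 2 ≤ z.im) :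
    (E₄ z).im = 0 ∧ 0 < (E₄ z).re := by
  have e : E₄ (negConj z) = E₄ z := by
    have := E₄_moebius (a := 1) (b := -n) (c := 0) (d := 1) (by norm_num) (z := z)
      (w := negConj z) (by
        have hn : (n : ℂ) = 2 * z.re := by exact_mod_cast h.symm
        have hc := Complex.add_conj (z : ℂ)
        rw [coe_re] at hc
        push_cast at hc
        rw [coe_negConj]
        push_cast
        rw [hn]
        linear_combination -hc)
    simpa using this
  rw [E₄_negConj, Complex.conj_eq_iff_im] at e
  refine ⟨e, ?_⟩
  have h1 := (Complex.abs_re_le_norm (E₄ z - 1)).trans_lt (norm_E₄_sub_one_lt him)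
  rw [Complex.sub_re, Complex.one_re, abs_lt] at h1
  linarith

/-- The point with real part `x` on the circle `|z| = 1 / √5`. -/
noncomputable def circlePoint (x : ℝ) (hx : x ^ 2 < 1 / 5) : ℍ :=
  ⟨⟨x, √(1 / 5 - x ^ 2)⟩, Real.sqrt_pos.mpr (by linarith)⟩

lemma circlePoint_re {x : ℝ} (hx : x ^ 2 < 1 / 5) : (circlePoint x hx).re = x := rfl

lemma circlePoint_im_sq {x : ℝ} (hx : x ^ 2 < 1 / 5) :
    (circlePoint x hx).im ^ 2 = 1 / 5 - x ^ 2 := Real.sq_sqrt (by linarith)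

/-- A sign change of `z² E₄(5 z)` on the circle `|z| = 1 / √5`. -/
lemma exists_re_eq_zero : ∃ z : ℍ, z.re ^ 2 + z.im ^ 2 = 1 / 5 ∧ -(2 / 5) < z.re ∧
    z.re < -(3 / 10) ∧ ((z : ℂ) ^ 2 * E₄ (natMul 5 (by norm_num) z)).re = 0 := by
  let p : ℝ → ℂ := fun x => ⟨x, √(1 / 5 - x ^ 2)⟩
  let h : ℝ → ℝ := fun x => (p x ^ 2 * E₄ (ofComplex (5 * p x))).re
  have hsq : ∀ x ∈ Set.Icc (-(2 / 5) : ℝ) (-(3 / 10)), x ^ 2 < 1 / 5 := fun x hx => by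
    nlinarith [hx.1, hx.2]
  have hval : ∀ x (hx : x ^ 2 < 1 / 5), h x = ((circlePoint x hx : ℂ) ^ 2 *
      E₄ (natMul 5 (by norm_num) (circlePoint x hx))).re := by
    intro x hx
    have : 5 * p x = (natMul 5 (by norm_num) (circlePoint x hx) : ℂ) := by
      rw [coe_natMul]; rfl
    simp only [h]
    rw [this, ofComplex_apply]
    rfl
  have hp : Continuous p := by
    have : p = fun x : ℝ => (x : ℂ) + (√(1 / 5 - x ^ 2) : ℝ) * Complex.I := by
      ext x; exact Complex.mk_eq_add_mul_I _ _
    rw [this]; fun_prop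
  have hcont : ContinuousOn h (Set.Icc (-(2 / 5)) (-(3 / 10))) := by
    have hE : ContinuousOn (E₄ ∘ ofComplex) {z | 0 < z.im} :=
      (UpperHalfPlane.mdifferentiable_iff.mp (ModularFormClass.holo E₄)).continuousOn
    have h2 : ContinuousOn (fun x => (E₄ ∘ ofComplex) (5 * p x))
        (Set.Icc (-(2 / 5)) (-(3 / 10))) := by
      refine hE.comp (hp.const_mul 5 |>.continuousOn) fun x hx => ?_
      have := (natMul 5 (by norm_num) (circlePoint x (hsq x hx))).im_pos
      rw [← coe_im, coe_natMul] at this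
      exact this
    exact Complex.continuous_re.comp_continuousOn ((hp.pow 2).continuousOn.mul h2)
  have hle : (-(2 / 5) : ℝ) ≤ -(3 / 10) := by norm_num
  have hre : ∀ z w : ℂ, w.im = 0 → (z ^ 2 * w).re = (z.re ^ 2 - z.im ^ 2) * w.re := by
    intro z w hw
    rw [Complex.mul_re, hw, pow_two, Complex.mul_re]; ring
  -- At the endpoints `5z` has real part `-2` and `-3/2`, so `E₄(5z)` is positive and the sign is
  -- that of `Re z²`, namely `3/25` and `-2/100`.
  have hl : 0 < h (-(2 / 5)) := by
    have hx := hsq _ (Set.left_mem_Icc.mpr hle)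
    rw [hval _ hx]
    obtain ⟨i1, i2⟩ := E₄_of_re_int (z := natMul 5 (by norm_num) (circlePoint _ hx))
      (n := -2) (by rw [natMul_re, circlePoint_re]; norm_num)
    rw [hre _ _ i1, coe_re, coe_im, circlePoint_re, circlePoint_im_sq]
    refine mul_pos (by norm_num) i2
  have hr : h (-(3 / 10)) < 0 := by
    have hx := hsq _ (Set.right_mem_Icc.mpr hle)
    rw [hval _ hx]
    obtain ⟨i1, i2⟩ := E₄_of_re_half_odd (z := natMul 5 (by norm_num) (circlePoint _ hx))
      (n := -3) (by rw [natMul_re, circlePoint_re]; norm_num) (by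
        rw [natMul_im]
        have h1 := circlePoint_im_sq hx
        have h2 := (circlePoint _ hx).im_pos
        push_cast
        nlinarith)
    rw [hre _ _ i1, coe_re, coe_im, circlePoint_re, circlePoint_im_sq]
    exact mul_neg_of_neg_of_pos (by norm_num) i2
  obtain ⟨x, hx, hx0⟩ := intermediate_value_Icc' hle hcont ⟨hr.le, hl.le⟩
  have hxs := hsq x hx
  refine ⟨circlePoint x hxs, by rw [circlePoint_im_sq, circlePoint_re]; ring, ?_, ?_, ?_⟩
  · rw [circlePoint_re]
    refine lt_of_le_of_ne hx.1 ?_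
    rintro rfl
    exact hl.ne' hx0
  · rw [circlePoint_re]
    refine lt_of_le_of_ne hx.2 ?_
    rintro rfl
    exact hr.ne hx0
  · rw [← hval x hxs, hx0]

/-- On this circle `-1/(5z) = -z̄`. -/
lemma jInv_natMul_eq_negConj {z : ℍ} (hz : z.re ^ 2 + z.im ^ 2 = 1 / 5) :
    jInv (natMul 5 (by norm_num) z) = jInv (negConj z) ∧
    (starRingEnd ℂ) (E₄ z) = (5 * z) ^ 4 * E₄ (natMul 5 (by norm_num) z) := by
  have hn : (z : ℂ) * (starRingEnd ℂ) z = 1 / 5 := by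
    rw [Complex.mul_conj, Complex.normSq_apply, coe_re, coe_im]
    have : z.re * z.re + z.im * z.im = 1 / 5 := by linarith
    rw [this]; norm_num
  have hw : (negConj z : ℂ) * ((1 : ℤ) * (natMul 5 (by norm_num) z : ℂ) + (0 : ℤ)) =
      (0 : ℤ) * (natMul 5 (by norm_num) z : ℂ) + (-1 : ℤ) := by
    rw [coe_negConj, coe_natMul]; push_cast; linear_combination -5 * hn
  refine ⟨(jInv_moebius (by norm_num) hw).symm, ?_⟩
  rw [← E₄_negConj, E₄_moebius (by norm_num) hw, coe_natMul]
  push_cast; ring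

/-- A zero of `E₄(z) + 25 E₄(5 z)` on the circle `|z| = 1 / √5`. -/
lemma exists_E₄_add_eq_zero : ∃ z : ℍ, z.re ^ 2 + z.im ^ 2 = 1 / 5 ∧ -(2 / 5) < z.re ∧
    z.re < -(3 / 10) ∧ E₄ z + 25 * E₄ (natMul 5 (by norm_num) z) = 0 := by
  obtain ⟨z, h1, h2, h3, h4⟩ := exists_re_eq_zero
  refine ⟨z, h1, h2, h3, ?_⟩
  have e := congrArg (starRingEnd ℂ) (jInv_natMul_eq_negConj h1).2
  rw [Complex.conj_conj] at e
  have hn : (z : ℂ) * (starRingEnd ℂ) z = 1 / 5 := by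
    rw [Complex.mul_conj, Complex.normSq_apply, coe_re, coe_im]
    have : z.re * z.re + z.im * z.im = 1 / 5 := by linarith
    rw [this]; norm_num
  -- On the circle `z² E₄(z) = 25 T̄`, so `z² (E₄(z) + 25 E₄(5z)) = 50 Re T`.
  set T := (z : ℂ) ^ 2 * E₄ (natMul 5 (by norm_num) z) with hT
  have hTT : T + (starRingEnd ℂ) T = 0 := by
    rw [Complex.add_conj, h4]; simp
  apply mul_left_cancel₀ (pow_ne_zero 2 z.ne_zero)
  have e2 : E₄ z = 625 * (starRingEnd ℂ) z ^ 2 * (starRingEnd ℂ) T := by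
    rw [e, hT]
    simp only [map_mul, map_pow, map_ofNat]
    ring
  rw [e2]
  linear_combination 25 * hTT + 625 * (starRingEnd ℂ) T *
    (z * (starRingEnd ℂ) z + 1 / 5) * hn

/-- Equality would make `10 c Re z` an integer with `|c| ≤ 2`. But `10 Re z` lies in `(-4, -3)`, and
for `c = ±2` the imaginary part formula puts `20 Re z` in `(-8, -7)`. -/
lemma jInv_ne_of_re_bounds {z : ℍ} (hz : z.re ^ 2 + z.im ^ 2 = 1 / 5) (h1 : -(2 / 5) < z.re)
    (h2 : z.re < -(3 / 10)) : jInv z ≠ jInv (natMul 5 (by norm_num) z) := by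
  intro h
  obtain ⟨a, b, c, d, hdet, e1, e2, e3⟩ := exists_matrix_of_jInv_natMul _ h
  have hc := coeff_ne_zero_of_det (by norm_num) hdet e1
  push_cast at e1 e2 e3
  have hy : 1 / 25 < z.im ^ 2 := by nlinarith
  have hc2 : c ^ 2 < 5 := by
    have : (c : ℝ) ^ 2 < 5 := by
      have : (0 : ℝ) < c ^ 2 := by positivity
      nlinarith [sq_nonneg ((a : ℝ) + 5 * d)]
    exact_mod_cast this
  have hc1 : c = 1 ∨ c = -1 ∨ c = 2 ∨ c = -2 := by
    have : c ≤ 2 := by nlinarith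
    have : -2 ≤ c := by nlinarith
    omega
  have hint : ∀ (n m : ℤ) (t : ℝ), (n : ℝ) = t → (m : ℝ) < t → t < m + 1 → False := by
    intro n m t h1 h2 h3
    rw [← h1] at h2 h3
    have h2 : m < n := by exact_mod_cast h2
    have h3 : n < m + 1 := by exact_mod_cast h3
    omega
  have htwo : (c : ℝ) ^ 2 = 4 → 3 / 20 ≤ z.re ^ 2 := fun h => by
    rw [h] at e3
    nlinarith [sq_nonneg ((a : ℝ) + 5 * d)]
  rcases hc1 with rfl | rfl | rfl | rfl
  · exact hint (a - 5 * d) (-4) (10 * z.re) (by push_cast at e1 ⊢; linarith)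
      (by push_cast; linarith) (by push_cast; linarith)
  · exact hint (a - 5 * d) 3 (-10 * z.re) (by push_cast at e1 ⊢; linarith)
      (by push_cast; linarith) (by push_cast; linarith)
  · have := htwo (by norm_num)
    exact hint (a - 5 * d) (-8) (20 * z.re) (by push_cast at e1 ⊢; linarith)
      (by push_cast; linarith) (by push_cast; nlinarith)
  · have := htwo (by norm_num)
    exact hint (a - 5 * d) 7 (-20 * z.re) (by push_cast at e1 ⊢; linarith)
      (by push_cast; nlinarith) (by push_cast; linarith)

end

/-! ### Zeros of forms with a Fricke functional equation -/

section

open UpperHalfPlane ModularForm EisensteinSeries Complex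

open Filter Topology

namespace FrickeForm

lemma jInv_eq_of_zero {N k : ℕ} {χ₀ : DirichletCharacter ℂ N} {C : ℂ} {g : ℂ → ℂ}
    (hg : FrickeForm N k χ₀ C g) (hpar : χ₀ (-1) = (-1) ^ k)
    (hN : N = 2 ∨ N = 3 ∨ (N = 5 ∧ Even k))
    (hw : k * (N + 1) = 4 ∨ k * (N + 1) = 6 ∨ k * (N + 1) = 8 ∨ k * (N + 1) = 12) {z : ℍ}
    (hz : g z = 0) (hN0 : 0 < N) : jInv z = jInv (natMul N hN0 z) := by
  obtain ⟨F, hF, h1⟩ := hg.exists_norm_form hpar hN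
  exact jInv_eq_of_levelOne_zero hw F h1 (by rw [hF, frickeNorm_eq_zero hz])
    (by rw [hF, coe_natMul, frickeNorm_mul_eq_zero hN0 hz])

/-- The norm is `E₄` times a weight 12 form. If `E₄` vanishes at one of `z`, `3z`, then `E₄(z) + C
E₄(3z) = 0` with `C ≠ 0` makes it vanish at the other. -/
lemma jInv_eq_of_zero_three {C : ℂ} {f : ℍ → ℂ}
    (hg : FrickeForm 3 4 1 C (f ∘ ofComplex))
    (hf : f ∈ eisensteinSpace 3 4 (1 : DirichletCharacter ℂ 3))
    (h1 : Tendsto f atImInfty (𝓝 1)) {z : ℍ} (hz : f z = 0) :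
    jInv z = jInv (natMul 3 (by norm_num) z) := by
  have hz' : (f ∘ ofComplex) z = 0 := by rw [Function.comp_apply, ofComplex_apply, hz]
  obtain ⟨a, ha, hab⟩ := hg.eq_E₄_add Nat.prime_three hf h1
  obtain ⟨F, hF, hF1⟩ := hg.exists_norm_form (by rw [MulChar.one_apply (by decide)]; norm_num)
    (Or.inr (Or.inl rfl))
  obtain ⟨d, hd⟩ := levelOne_weight_sixteen_zero F hF1
  have hC : C ≠ 0 := by
    rintro rfl
    have := hg.sq_eq
    norm_num at this
  rw [hab, mul_eq_zero, or_iff_right ha] at hz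
  rcases hd z (by rw [hF, frickeNorm_eq_zero hz']) with h | h
  · have h3 : E₄ (natMul 3 (by norm_num) z) = 0 := by
      rw [h, zero_add, mul_eq_zero, or_iff_right hC] at hz
      exact hz
    rw [jInv_eq_zero_iff.mpr h, jInv_eq_zero_iff.mpr h3]
  · rcases hd (natMul 3 (by norm_num) z) (by
      rw [hF, coe_natMul, frickeNorm_mul_eq_zero (by norm_num) hz']) with h3 | h3
    · have h4 : E₄ z = 0 := by
        rw [h3, mul_zero, add_zero] at hz
        exact hz
      rw [jInv_eq_zero_iff.mpr h4, jInv_eq_zero_iff.mpr h3]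
    · rw [h, h3]

/-- The `j`-invariants of the zeros at level `5` and weight `4`, given two zeros `p`, `q` of the
norm with distinct `j`-invariants. -/
lemma jInv_of_zero_five {χ₀ : DirichletCharacter ℂ 5} {C : ℂ} {g : ℂ → ℂ}
    (hg : FrickeForm 5 4 χ₀ C g) (hpar : χ₀ (-1) = (-1) ^ 4) {p q z : ℍ}
    (hp : frickeNorm 5 g p = 0) (hq : frickeNorm 5 g q = 0) (hpq : jInv p ≠ jInv q)
    (hz : g z = 0) :
    jInv z = jInv (natMul 5 (by norm_num) z) ∨
      (jInv z = jInv p ∧ jInv (natMul 5 (by norm_num) z) = jInv q) ∨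
      (jInv z = jInv q ∧ jInv (natMul 5 (by norm_num) z) = jInv p) := by
  obtain ⟨F, hF, h1⟩ := hg.exists_norm_form hpar (Or.inr (Or.inr ⟨rfl, by decide⟩))
  obtain ⟨d, e, hde⟩ := levelOne_weight_twentyfour_zero F h1
  have ep := hde p (by rw [hF, hp])
  have eq := hde q (by rw [hF, hq])
  have hroot : ∀ w : ℍ, F w = 0 → jInv w = jInv p ∨ jInv w = jInv q := by
    intro w hw
    have hsum : jInv p + jInv q + d = 0 := by
      apply mul_left_cancel₀ (sub_ne_zero.mpr hpq)
      linear_combination ep - eq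
    have : (jInv w - jInv p) * (jInv w - jInv q) = 0 := by
      linear_combination hde w hw - ep + (jInv p - jInv w) * hsum
    rcases mul_eq_zero.mp this with h | h
    · exact Or.inl (sub_eq_zero.mp h)
    · exact Or.inr (sub_eq_zero.mp h)
  rcases hroot z (by rw [hF, frickeNorm_eq_zero hz]) with h | h <;>
    rcases hroot (natMul 5 (by norm_num) z) (by
      rw [hF, coe_natMul, frickeNorm_mul_eq_zero (by norm_num) hz]) with h' | h'
  · exact Or.inl (h.trans h'.symm)
  · exact Or.inr (Or.inl ⟨h, h'⟩)
  · exact Or.inr (Or.inr ⟨h, h'⟩)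
  · exact Or.inl (h.trans h'.symm)

end FrickeForm

/-! ### Forced zeros at quadratic points of level five -/

/-- The fixed point `i / √5` of the Fricke involution of level `5`. -/
noncomputable def frickePoint : ℍ := ⟨⟨0, 1 / √5⟩, by positivity⟩

/-- The elliptic point `-1/2 + i / (2√5)`. -/
noncomputable def halfPoint : ℍ := ⟨⟨-1 / 2, 1 / (2 * √5)⟩, by positivity⟩

/-- The elliptic point `(-2 + i) / 5` of `Γ₀(5)`. -/
noncomputable def ellipticPoint : ℍ := ⟨⟨-2 / 5, 1 / 5⟩, by norm_num⟩

lemma sq_one_div_sqrt_five : (1 / √5) ^ 2 = 1 / 5 := by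
  rw [div_pow, Real.sq_sqrt (by norm_num), one_pow]

lemma frickePoint_sq : 5 * (frickePoint : ℂ) ^ 2 + 1 = 0 := by
  have h := sq_one_div_sqrt_five
  apply Complex.ext <;> simp [frickePoint, pow_two] at h ⊢
  linarith

lemma halfPoint_sq : 10 * (halfPoint : ℂ) ^ 2 + 10 * halfPoint + 3 = 0 := by
  have h := sq_one_div_sqrt_five
  apply Complex.ext <;> simp [halfPoint, pow_two] at h ⊢
  · linarith
  · ring

lemma ellipticPoint_sq : 5 * (ellipticPoint : ℂ) ^ 2 + 4 * ellipticPoint + 1 = 0 := by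
  apply Complex.ext <;> (simp [ellipticPoint, pow_two]; norm_num)

lemma isCM_frickePoint : IsCM (-20) frickePoint :=
  ⟨5, 0, 1, by norm_num, by push_cast; linear_combination frickePoint_sq, by norm_num⟩

lemma isCM_halfPoint : IsCM (-20) halfPoint :=
  ⟨10, 10, 3, by norm_num, by push_cast; linear_combination halfPoint_sq, by norm_num⟩

lemma isCM_ellipticPoint : IsCM (-4) ellipticPoint :=
  ⟨5, 4, 1, by norm_num, by push_cast; linear_combination ellipticPoint_sq, by norm_num⟩

/-- The two points represent different classes of discriminant `-20`: an equivalence would solve `c²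
+ 5d² = 10` in integers. -/
lemma jInv_frickePoint_ne_jInv_halfPoint : jInv frickePoint ≠ jInv halfPoint := by
  intro h
  obtain ⟨a, b, c, d, hdet, hw⟩ := exists_moebius_of_jInv_eq h
  have hre := congrArg Complex.re hw
  have him := congrArg Complex.im hw
  have hs : √5 ≠ 0 := by positivity
  have hs2 := sq_one_div_sqrt_five
  rw [one_div] at hs2
  simp [frickePoint, halfPoint] at hre him
  set s := (√5)⁻¹
  have hs0 : s ≠ 0 := inv_ne_zero hs
  have e1 : (d : ℝ) - c = 2 * a := by
    apply mul_right_cancel₀ hs0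
    linear_combination 2 * him
  have e2 : 5 * (d : ℝ) + c = -10 * b := by
    linear_combination -10 * hre - 5 * c * hs2
  have e1' : d = c + 2 * a := by
    have : (d : ℝ) = c + 2 * a := by linarith
    exact_mod_cast this
  have e2' : c = -10 * b - 5 * d := by
    have : (c : ℝ) = -10 * b - 5 * d := by linarith
    exact_mod_cast this
  have : c ^ 2 + 5 * d ^ 2 = 10 := by
    linear_combination 10 * hdet + 5 * d * e1' + c * e2'
  have h1 : d ≤ 1 := by nlinarith
  have h2 : -1 ≤ d := by nlinarith
  have h3 : c ≤ 3 := by nlinarith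
  have h4 : -3 ≤ c := by nlinarith
  interval_cases d <;> interval_cases c <;> omega

namespace FrickeForm

variable {χ₀ : DirichletCharacter ℂ 5} {C : ℂ} {g : ℂ → ℂ}

/-- At this fixed point `z⁴ = 1/25`, so the Fricke equation reads `g = -g`. -/
lemma zero_frickePoint (hg : FrickeForm 5 4 χ₀ C g) (hC : C = -25) : g frickePoint = 0 := by
  have h := hg.fricke frickePoint frickePoint.im_pos
  have hp := frickePoint_sq
  have hne := frickePoint.ne_zero
  have e : -1 / (((5 : ℕ) : ℂ) * frickePoint) = frickePoint := by
    push_cast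
    field_simp
    linear_combination -hp
  have e4 : (frickePoint : ℂ) ^ 4 = 1 / 25 := by
    linear_combination (frickePoint ^ 2 / 5 - 1 / 25) * hp
  rw [e, e4, hC] at h
  linear_combination h / 2

/-- The point is fixed by `(2, 1; 5, 3)` followed by the Fricke involution. The total factor is `C
χ₀(3) (2z+1)⁴`, with `2z + 1 = i/√5`. -/
lemma zero_halfPoint (hg : FrickeForm 5 4 χ₀ C g) (hC : C * χ₀ 3 = -25) : g halfPoint = 0 := by
  set z : ℂ := (halfPoint : ℂ)
  have hz : 0 < z.im := halfPoint.im_pos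
  have hp : 10 * z ^ 2 + 10 * z + 3 = 0 := halfPoint_sq
  have hden : 5 * z + 3 ≠ 0 := by
    intro h0
    have := congrArg Complex.im h0
    simp at this
    exact hz.ne' this
  have hnum : 2 * z + 1 ≠ 0 := by
    intro h0
    have := congrArg Complex.im h0
    simp at this
    exact hz.ne' this
  have h1 := hg.gamma 2 1 1 3 (by norm_num) z hz
  have him : 0 < ((2 * z + 1) / (5 * z + 3)).im := by
    have : (2 * z + 1) / (5 * z + 3) = (-1 / (5 * z)) := by
      have hz0 : z ≠ 0 := halfPoint.ne_zero
      rw [div_eq_div_iff hden (mul_ne_zero (by norm_num) hz0)]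
      linear_combination hp
    rw [this]
    exact im_neg_inv_pos (im_natMul_pos (n := 5) (by norm_num) hz)
  have h2 := hg.fricke _ him
  have e : -1 / (((5 : ℕ) : ℂ) * ((2 * z + 1) / (5 * z + 3))) = z := by
    push_cast
    field_simp
    linear_combination -hp
  push_cast at h1 h2 e
  simp only [mul_one] at h1
  rw [e, h1] at h2
  have e4 : (2 * z + 1) ^ 4 = 1 / 25 := by
    linear_combination (8 / 5 * z ^ 2 + 8 / 5 * z + 8 / 25) * hp
  have h3 : g z = C * χ₀ 3 * (2 * z + 1) ^ 4 * g z := by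
    rw [div_pow] at h2
    have hd := div_mul_cancel₀ ((2 * z + 1) ^ 4) (pow_ne_zero 4 hden)
    linear_combination h2 + C * χ₀ 3 * g z * hd
  rw [e4, hC] at h3
  linear_combination h3 / 2

/-- The stabilizing matrix `(-2, -1; 5, 2)` has automorphy factor `5z + 2 = i`, and `i⁴ = 1`, so the
character value `-1` forces a zero. -/
lemma zero_ellipticPoint (hg : FrickeForm 5 4 χ₀ C g) (hχ : χ₀ 2 = -1) : g ellipticPoint = 0 := by
  set z : ℂ := (ellipticPoint : ℂ) with hzdef
  have hz : 0 < z.im := ellipticPoint.im_pos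
  have hp : 5 * z ^ 2 + 4 * z + 1 = 0 := ellipticPoint_sq
  have hI : 5 * z + 2 = Complex.I := by
    apply Complex.ext
    · simp [hzdef, ellipticPoint]; norm_num
    · simp [hzdef, ellipticPoint]
  have h1 := hg.gamma (-2) (-1) 1 2 (by norm_num) z hz
  have e : (-2 * z + -1) / (5 * z + 2) = z := by
    rw [div_eq_iff (by rw [hI]; exact Complex.I_ne_zero)]
    linear_combination -hp
  push_cast at h1
  rw [mul_one, e, hI, hχ, Complex.I_pow_four] at h1
  linear_combination h1 / 2

end FrickeForm

end

/-! ### Weight four at level five -/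

section

open UpperHalfPlane ModularForm EisensteinSeries Complex

open Filter Topology

lemma dirichletCharacter_three_eq_one {χ₀ : DirichletCharacter ℂ 3} (h : χ₀ (-1) = 1) :
    χ₀ = 1 := by
  refine MulChar.ext fun u => ?_
  rw [MulChar.one_apply u.isUnit]
  have : ∀ a : (ZMod 3)ˣ, (a : ZMod 3) = 1 ∨ (a : ZMod 3) = -1 := by decide
  rcases this u with hu | hu <;> rw [hu]
  · exact map_one χ₀
  · exact h

lemma dirichletCharacter_five_eq_one {χ₀ : DirichletCharacter ℂ 5} (h : χ₀ 2 = 1) :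
    χ₀ = 1 := by
  refine MulChar.ext fun u => ?_
  rw [MulChar.one_apply u.isUnit]
  have : ∀ a : (ZMod 5)ˣ, (a : ZMod 5) = 2 ^ 0 ∨ (a : ZMod 5) = 2 ^ 1 ∨ (a : ZMod 5) = 2 ^ 2 ∨
      (a : ZMod 5) = 2 ^ 3 := by decide
  rcases this u with hu | hu | hu | hu <;> rw [hu, map_pow, h, one_pow]

/-- A real character modulo `5` is even. -/
lemma isQuadratic_five {χ₀ : DirichletCharacter ℂ 5} (h : χ₀.IsQuadratic) :
    χ₀ (-1) = 1 ∧ (χ₀ = 1 ∨ (χ₀ 2 = -1 ∧ χ₀ 3 = -1)) := by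
  have h4 : χ₀ (-1) = χ₀ 2 ^ 2 := by rw [← map_pow]; congr 1
  have h3 : χ₀ 3 = χ₀ 2 ^ 3 := by rw [← map_pow]; congr 1
  rcases h 2 with h2 | h2 | h2
  · exact absurd h2 (((by decide : IsUnit (2 : ZMod 5)).map χ₀).ne_zero)
  · rw [h4, h2]
    exact ⟨one_pow 2, Or.inl (dirichletCharacter_five_eq_one h2)⟩
  · rw [h4, h3, h2]
    norm_num

namespace FrickeForm

lemma C_eq_five {χ₀ : DirichletCharacter ℂ 5} {C : ℂ} {g : ℂ → ℂ}
    (hg : FrickeForm 5 4 χ₀ C g) : C = 25 ∨ C = -25 := by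
  have : (C - 25) * (C + 25) = 0 := by
    have := hg.sq_eq
    push_cast at this
    linear_combination this
  rcases mul_eq_zero.mp this with h | h
  · exact Or.inl (sub_eq_zero.mp h)
  · exact Or.inr (eq_neg_of_add_eq_zero_left h)

lemma mem_arc5_of_quadratic {χ₀ : DirichletCharacter ℂ 5} {C : ℂ} {g : ℂ → ℂ}
    (hg : FrickeForm 5 4 χ₀ C g) (hpar : χ₀ (-1) = (-1) ^ 4) (h2 : χ₀ 2 = -1) (h3 : χ₀ 3 = -1)
    {z : ℍ} (hz : z ∈ fundDomain5) (hz0 : g z = 0) : z ∈ arc5 := by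
  obtain ⟨p, hp, hpc⟩ : ∃ p : ℍ, g p = 0 ∧ IsCM (-20) p := by
    rcases hg.C_eq_five with hC | hC
    · exact ⟨halfPoint, hg.zero_halfPoint (by rw [hC, h3]; ring), isCM_halfPoint⟩
    · exact ⟨frickePoint, hg.zero_frickePoint hC, isCM_frickePoint⟩
  -- Discriminants `-4` and `-20` keep the two `j`-values apart, and the same irrationality excludes
  -- the mixed cases below, because `Im(5z) = 5 Im z`.
  have hne : jInv ellipticPoint ≠ jInv p := fun h =>
    IsCM.not_of_im (r := 1) (z := p) (by simp)
      (isCM_ellipticPoint.of_jInv_eq (by norm_num) h) hpc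
  rcases hg.jInv_of_zero_five hpar (frickeNorm_eq_zero (hg.zero_ellipticPoint h2))
    (frickeNorm_eq_zero hp) hne hz0 with h | ⟨h, h'⟩ | ⟨h, h'⟩
  · exact mem_arc5_of_jInv hz h
  · exact (IsCM.not_of_im (r := 5) (by rw [natMul_im]; push_cast; rfl)
      (isCM_ellipticPoint.of_jInv_eq (by norm_num) h.symm)
      (hpc.of_jInv_eq (by norm_num) h'.symm)).elim
  · exact (IsCM.not_of_im (r := 1 / 5) (by rw [natMul_im]; push_cast; ring)
      (isCM_ellipticPoint.of_jInv_eq (by norm_num) h'.symm)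
      (hpc.of_jInv_eq (by norm_num) h.symm)).elim

lemma mem_arc5_of_trivial {C : ℂ} {f : ℍ → ℂ}
    (hg : FrickeForm 5 4 1 C (f ∘ ofComplex))
    (hf : f ∈ eisensteinSpace 5 4 (1 : DirichletCharacter ℂ 5))
    (h1 : Tendsto f atImInfty (𝓝 1)) {z : ℍ} (hz : z ∈ fundDomain5) (hz0 : f z = 0) :
    z ∈ arc5 := by
  have hpar : (1 : DirichletCharacter ℂ 5) (-1) = (-1) ^ 4 := by
    rw [MulChar.one_apply (by decide)]; norm_num
  have hz0' : (f ∘ ofComplex) z = 0 := by rw [Function.comp_apply, ofComplex_apply, hz0]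
  rcases hg.C_eq_five with rfl | rfl
  · obtain ⟨a, -, hab⟩ := hg.eq_E₄_add Nat.prime_five hf h1
    obtain ⟨p, hp, hp1, hp2, hp3⟩ := exists_E₄_add_eq_zero
    have hfp : (f ∘ ofComplex) p = 0 := by
      rw [Function.comp_apply, ofComplex_apply, hab, hp3, mul_zero]
    have hneg := (jInv_natMul_eq_negConj hp).1
    have hcc : ∀ w : ℍ, negConj (negConj w) = w := fun w => by
      apply UpperHalfPlane.ext
      simp
    rcases hg.jInv_of_zero_five hpar (frickeNorm_eq_zero hfp)
      (q := natMul 5 (by norm_num) p) (by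
        rw [coe_natMul]; exact frickeNorm_mul_eq_zero (by norm_num) hfp)
      (jInv_ne_of_re_bounds hp hp1 hp2) hz0' with h | ⟨h, h'⟩ | ⟨h, h'⟩
    · exact mem_arc5_of_jInv hz h
    -- Since `j(5p) = j(-p̄)`, the mixed case `j(z) = j(p)`, `j(5z) = j(5p)` becomes `j(5z) =
    -- j(-z̄)`.
    · refine mem_arc5_of_jInv_negConj hz ?_
      rw [h', hneg, jInv_negConj_congr h]
    · refine mem_arc5_of_jInv_negConj hz ?_
      rw [h', jInv_negConj_congr (h.trans hneg), hcc]
  · rcases hg.jInv_of_zero_five hpar (frickeNorm_eq_zero (hg.zero_frickePoint rfl))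
      (frickeNorm_eq_zero (hg.zero_halfPoint (by rw [MulChar.one_apply (by decide), mul_one])))
      jInv_frickePoint_ne_jInv_halfPoint hz0' with h | ⟨h, h'⟩ | ⟨h, h'⟩
    · exact mem_arc5_of_jInv hz h
    · exact mem_arc5_of_isCM hz (isCM_frickePoint.of_jInv_eq (by norm_num) h.symm)
        (isCM_halfPoint.of_jInv_eq (by norm_num) h'.symm)
    · exact mem_arc5_of_isCM hz (isCM_halfPoint.of_jInv_eq (by norm_num) h.symm)
        (isCM_frickePoint.of_jInv_eq (by norm_num) h'.symm)

end FrickeForm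

end

theorem mainTheorem8 (N k : ℕ) (hk : 1 ≤ k) (hk4 : k ≤ 4)
    (χ₀ : DirichletCharacter ℂ N) (hreal : χ₀.IsQuadratic) (hparity : χ₀ (-1) = (-1) ^ k)
    (χ : Gamma0Plus N →* ℂˣ) (hχ : RestrictsTo χ χ₀)
    (E : UpperHalfPlane → ℂ) (hE : IsEisensteinPlus N k χ₀ χ E) :
    (N = 2 → ∀ z ∈ fundDomain 2, E z = 0 → (z : ℂ) ∈ arc2) ∧
    (N = 3 → ∀ z ∈ fundDomain 3, E z = 0 → (z : ℂ) ∈ arc3) ∧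
    (N = 5 → ∀ z ∈ fundDomain5, E z = 0 → z ∈ arc5) := by
  have heven : ((-1 : ℂ) ^ k = 1) → k = 2 ∨ k = 4 := by
    intro h
    rcases Nat.even_or_odd k with ⟨m, rfl⟩ | ho
    · omega
    · rw [ho.neg_one_pow] at h
      norm_num at h
  have hcomp : ∀ z : UpperHalfPlane, E z = 0 → (E ∘ UpperHalfPlane.ofComplex) z = 0 := fun z hz => by
    rw [Function.comp_apply, UpperHalfPlane.ofComplex_apply, hz]
  refine ⟨?_, ?_, ?_⟩
  · rintro rfl z hz hz0
    obtain ⟨C, hg⟩ := fricke_of_modular (by norm_num) hχ hE.modular hE.constantTerm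
    have h1 : χ₀ (-1) = 1 := by rw [show (-1 : ZMod 2) = 1 by decide, map_one]
    -- So `k` is 2 or 4 and the norm has weight 6 or 12.
    have hk2 := heven (hparity ▸ h1)
    obtain ⟨b1, b2⟩ := fundDomain_bounds (by norm_num) hz
    exact mem_arc2 hz (normSq_eq_of_jInv_two
      (hg.jInv_eq_of_zero hparity (Or.inl rfl) (by omega) (hcomp z hz0) _) b1 b2)
  · rintro rfl z hz hz0
    obtain ⟨C, hg⟩ := fricke_of_modular (by norm_num) hχ hE.modular hE.constantTerm
    obtain ⟨b1, b2⟩ := fundDomain_bounds (by norm_num) hz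
    refine mem_arc3 hz (normSq_eq_of_jInv_three ?_ b1 b2)
    by_cases hk' : k = 4
    · subst hk'
      obtain rfl := dirichletCharacter_three_eq_one (by rw [hparity]; norm_num)
      exact hg.jInv_eq_of_zero_three hE.mem_eisensteinSpace hE.constantTerm hz0
    -- For `k = 1, 2, 3` the norm has weight 4, 8, 12.
    · exact hg.jInv_eq_of_zero hparity (Or.inr (Or.inl rfl)) (by omega) (hcomp z hz0) _
  · rintro rfl z hz hz0
    obtain ⟨C, hg⟩ := fricke_of_modular (by norm_num) hχ hE.modular hE.constantTerm
    obtain ⟨h1, h2⟩ := isQuadratic_five hreal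
    rcases heven (hparity ▸ h1) with rfl | rfl
    · exact mem_arc5_of_jInv hz (hg.jInv_eq_of_zero hparity
        (Or.inr (Or.inr ⟨rfl, by decide⟩)) (by omega) (hcomp z hz0) _)
    · rcases h2 with rfl | ⟨h2, h3⟩
      · exact hg.mem_arc5_of_trivial hE.mem_eisensteinSpace hE.constantTerm hz hz0
      · exact hg.mem_arc5_of_quadratic hparity h2 h3 hz (hcomp z hz0)
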